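/- Work in a virtual equipment $\mathbb X$: a virtual double category with objects, tight-cells $f\colon A\to B$, loose-cells $p\colon A\nrightarrow B$ and 2-cells, equipped with loose-identities $A(1,1)$ and restrictions $q(f,g)$ of loose-cells along tight-cells. (A choice of restrictions is part of the structure; it may, but need not, be strictly functorial.) Write $B(f,g)$ for $B(1,1)(f,g)$. A weight $\vec p\colon Y\nrightarrow\cdots\nrightarrow Z$ is a chain $Z\nleftarrow\cdots\nleftarrow Y$ of loose-cells $p_1,\dots,p_m$ ($m\ge 0$). A right lift of $q\colon X\nrightarrow Z$ through $\vec p$ is a loose-cell $l\colon X\nrightarrow Y$ with a 2-cell $\varpi\colon \vec p,l\Rightarrow q$ through which every 2-cell $\vec p,r_1,\dots,r_n\Rightarrow q$ ($n\ge0$) factors uniquely. A colimit $\vec p\circledast f$ of $f\colon Z\to B$ is a tight-cell $c\colon Y\to B$ with a 2-cell $\vec p\Rightarrow B(f,c)$ such that the induced 2-cell $\vec p,B(c,1)\Rightarrow B(f,1)$ exhibits $B(c,1)$ as the right lift of $B(f,1)$ through $\vec p$. A tight-cell $g\colon B\to B'$ preserves this colimit if the induced cocone exhibits $c$ followed by $g$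 as the $\vec p$-colimit of $f$ followed by $g$. A loose-cell $p\colon W\nrightarrow B$ respects it if the induced 2-cell $\vec p,p(c,1)\Rightarrow p(f,1)$ exhibits $p(c,1)$ as the right lift of $p(f,1)$ through $\vec p$. The left extension of $f\colon Z\to B$ along $j\colon Z\to Y$ is the $Y(j,1)$-weighted colimit of $f$. A tight-cell $f\colon A\to B$ is fully faithful if $A(1,1)\cong B(f,f)$. A tight-cell $\ell\colon B\to A$ is left adjoint to $r\colon A\to B$ if $A(\ell,1)\cong B(1,r)$. An object $A$ is reflective in $B$ if there is a fully faithful tight-cell $A\to B$ admitting a left adjoint. Let $\Phi$ be a class of weights. A $\Phi$-colimit is a colimit weighted by some $\vec p\in\Phi$. An object $B$ is $\Phi$-cocomplete if it admits $\vec p\circledast f$ for every weight $\vec p\colon W\nrightarrow\cdots\nrightarrow D$ in $\Phi$ and every $f\colon D\to B$. A tight-cell with $\Phi$-cocomplete domain is $\Phi$-cocontinuous if it preserves $\Phi$-colimits, and a loose-cell with $\Phi$-cocomplete codomain is $\Phi$-exact if it respects $\Phi$-colimits. Write $\Phi\lesssim\Phi'$ if every $\Phi'$-cocomplete object is $\Phi$-cocomplete,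 every $\Phi'$-cocontinuous tight-cell with $\Phi'$-cocomplete domain is $\Phi$-cocontinuous, and every $\Phi'$-exact loose-cell with $\Phi'$-cocomplete codomain is $\Phi$-exact. The colimit saturation $\Phi^{\circledast}$ is the largest class of weights with $\Phi^{\circledast}\lesssim\Phi\lesssim\Phi^{\circledast}$. A $\Phi$-cocompletion of $A$ is a tight-cell $j\colon A\to E$ such that the following hold. (i) $E$ is $\Phi$-cocomplete. (ii) For every $f\colon A\to B$ with $B$ $\Phi$-cocomplete, the left extension $l\colon E\to B$ of $f$ along $j$ exists, its unit $f\Rightarrow lj$ is invertible, and $l$ is, up to isomorphism, the unique $\Phi$-cocontinuous tight-cell with $f\cong lj$. (iii) For every loose-cell $p\colon W\nrightarrow A$, the right lift $l$ of $p$ through $E(j,1)$ exists, the canonical 2-cell $l(j,1)\Rightarrow p$ is invertible, and $l$ is, up to isomorphism, the unique $\Phi$-exact loose-cell with $p\cong l(j,1)$. **Proposition.** Let $\Phi$ be a class of weights and $A$ an object. The following are equivalent. 1. $A$ is $\Phi$-cocomplete. 2. $A$ is reflective in a $\Phi$-cocomplete object. If $A$ admits a $\Phi$-cocompletion $\varphi_A\colon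 A\to\widehat\Phi A$, then the following are also equivalent to (1) and (2). 3. For every object $Y$ admitting a $\Phi$-cocompletion $\varphi_Y\colon Y\to\widehat\Phi Y$ and every $g\colon Y\to A$, the left extension of $g$ along $\varphi_Y$ exists. 4. The left extension of $1_A$ along $\varphi_A$ exists. 5. For every weight $\vec p\colon Y\nrightarrow\cdots\nrightarrow A$ in $\Phi^{\circledast}$, $A$ admits the colimit $\vec p\circledast 1_A$. 6. $\varphi_A$ admits a left adjoint. 7. $A$ is reflective in a $\Phi$-cocompletion (of some object). -/

import Mathlib

open CategoryTheory

universe w z v u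

namespace VDC

/-! ### Virtual double categories

A loose-cell from `A` to `B` is an element of `Loose A B`.  A chain
`p₁, …, pₘ` of loose-cells `X₀ ⇷ X₁ ⇷ ⋯ ⇷ Xₘ` is an element of `Chain Xₘ X₀`
(source first, as for loose-cells), and is listed from its target `X₀` on. -/

class HasLoose (X : Type u) where
  /-- Loose-cells from the first object to the second one. -/
  Loose : X → X → Type w

open HasLoose

/-- Chains of loose-cells with a given source. A weight is a chain of loose-cells. -/
inductive Chain {X : Type u} [HasLoose.{w} X] (Y : X) : X → Type (max u w)
  | nil : Chain Y Y
  | cons {X₁ X₀ : X} (p : Loose X₁ X₀) (P : Chain Y X₁) : Chain Y X₀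

namespace Chain

variable {X : Type u} [HasLoose.{w} X]

/-- The chain consisting of one loose-cell. -/
abbrev single {A B : X} (p : Loose A B) : Chain A B := cons p nil

/-- The chain `p₁, …, pₘ, r₁, …, rₙ`. -/
def append {W Y : X} : {Z : X} → Chain Y Z → Chain W Y → Chain W Z
  | _, nil, R => R
  | _, cons p P, R => cons p (append P R)

theorem append_nil {Y : X} : {Z : X} → (P : Chain Y Z) → P.append nil = P
  | _, nil => rfl
  | _, cons p P => congrArg (cons p) (append_nil P)

theorem append_assoc {V W Y : X} : {Z : X} → (P : Chain Y Z) → (Q : Chain W Y) → (R : Chain V W) →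
    (P.append Q).append R = P.append (Q.append R)
  | _, nil, _, _ => rfl
  | _, cons p P, Q, R => congrArg (cons p) (append_assoc P Q R)

end Chain

/-- `Cell f g P q` is the type of 2-cells whose frame has the chain `P` on top, the loose-cell `q`
at the bottom, the tight-cell `f` between the targets of `P` and `q` (the left-hand side of the
frame, when chains are drawn from right to left), and the tight-cell `g` between their sources. -/
class HasCells (X : Type u) [Category.{v} X] extends HasLoose.{w} X where
  Cell : {A₀ A₁ B₀ B₁ : X} → (A₀ ⟶ B₀) → (A₁ ⟶ B₁) → Chain A₁ A₀ → Loose B₁ B₀ → Type z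

open HasCells

/-- `Cells f f' P Q` is the type of rows `φ₁, …, φₙ` of horizontally adjacent 2-cells, where
`Q = (q₁, …, qₙ)` consists of the codomains of the 2-cells, `P` is the concatenation of their
domains, and `f` and `f'` are the outermost tight-cells. (The equation in `cons` allows for
concatenations that hold only propositionally.) A row of length zero is a tight-cell. -/
inductive Cells {X : Type u} [Category.{v} X] [HasCells.{w, z} X] :
    {A₀ A₁ B₀ B₁ : X} → (A₀ ⟶ B₀) → (A₁ ⟶ B₁) → Chain A₁ A₀ → Chain B₁ B₀ → Type (max u v w z)
  | nil {A B : X} (f : A ⟶ B) : Cells f f Chain.nil Chain.nil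
  | cons {A₀ A₁ A₂ B₀ B₁ B₂ : X} {f : A₀ ⟶ B₀} {h : A₁ ⟶ B₁} {f' : A₂ ⟶ B₂}
      {P : Chain A₁ A₀} {P' : Chain A₂ A₁} {R : Chain A₂ A₀} {q : Loose B₁ B₀} {Q : Chain B₂ B₁}
      (φ : Cell f h P q) (Φ : Cells h f' P' Q) (e : P.append P' = R) :
      Cells f f' R (Chain.cons q Q)

namespace Cells

variable {X : Type u} [Category.{v} X] [HasCells.{w, z} X]

/-- The row consisting of one 2-cell. -/
def single {A₀ A₁ B₀ B₁ : X} {f : A₀ ⟶ B₀} {f' : A₁ ⟶ B₁} {P : Chain A₁ A₀} {q : Loose B₁ B₀}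
    (φ : Cell f f' P q) : Cells f f' P (Chain.single q) :=
  cons φ (nil f') P.append_nil

/-- Juxtaposition of rows. -/
def append {A₀ A₁ A₂ B₀ B₁ B₂ : X} {f : A₀ ⟶ B₀} {h : A₁ ⟶ B₁} {f' : A₂ ⟶ B₂}
    {P : Chain A₁ A₀} {P' : Chain A₂ A₁} {Q : Chain B₁ B₀} {Q' : Chain B₂ B₁} :
    Cells f h P Q → Cells h f' P' Q' → Cells f f' (P.append P') (Q.append Q')
  | nil _, Ψ => Ψ
  | cons φ Φ e, Ψ => cons φ (append Φ Ψ) (by rw [← e, Chain.append_assoc])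

end Cells

/-- Identity 2-cells and composition of a row of 2-cells with a 2-cell below it. (The frame of the
composite is allowed to be equal only propositionally to `f ≫ g`, `f' ≫ g'`.) -/
class HasComp (X : Type u) [Category.{v} X] extends HasCells.{w, z} X where
  idCell {A B : X} (p : Loose A B) : Cell (𝟙 B) (𝟙 A) (Chain.single p) p
  comp {A₀ A₁ B₀ B₁ C₀ C₁ : X} {f : A₀ ⟶ B₀} {f' : A₁ ⟶ B₁} {g : B₀ ⟶ C₀} {g' : B₁ ⟶ C₁}
    {k : A₀ ⟶ C₀} {k' : A₁ ⟶ C₁} {P : Chain A₁ A₀} {Q : Chain B₁ B₀} {r : Loose C₁ C₀}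
    (Φ : Cells f f' P Q) (ψ : Cell g g' Q r) (e : f ≫ g = k) (e' : f' ≫ g' = k') : Cell k k' P r

open HasComp

/-- The row of identity 2-cells on a chain. -/
def Cells.ids {X : Type u} [Category.{v} X] [HasComp.{w, z} X] :
    {Y Z : X} → (P : Chain Y Z) → Cells (𝟙 Z) (𝟙 Y) P P
  | _, _, Chain.nil => Cells.nil (𝟙 _)
  | _, _, Chain.cons p P => Cells.cons (idCell p) (Cells.ids P) rfl

/-- Configurations consisting of a row `ψ₁, …, ψₙ` of 2-cells together with, for each `i`, a row
`Φᵢ` of 2-cells on top of `ψᵢ`, composable with it. -/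
inductive Cells₂ {X : Type u} [Category.{v} X] [HasComp.{w, z} X] :
    {A₀ A₁ B₀ B₁ C₀ C₁ : X} → (A₀ ⟶ B₀) → (A₁ ⟶ B₁) → (B₀ ⟶ C₀) → (B₁ ⟶ C₁) →
    Chain A₁ A₀ → Chain B₁ B₀ → Chain C₁ C₀ → Type (max u v w z)
  | nil {A B C : X} (f : A ⟶ B) (g : B ⟶ C) :
      Cells₂ f f g g Chain.nil Chain.nil Chain.nil
  | cons {A₀ A₁ A₂ B₀ B₁ B₂ C₀ C₁ C₂ : X} {f : A₀ ⟶ B₀} {h : A₁ ⟶ B₁} {f' : A₂ ⟶ B₂}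
      {g : B₀ ⟶ C₀} {k : B₁ ⟶ C₁} {g' : B₂ ⟶ C₂}
      {P : Chain A₁ A₀} {P' : Chain A₂ A₁} {Q : Chain B₁ B₀} {Q' : Chain B₂ B₁}
      {r : Loose C₁ C₀} {R : Chain C₂ C₁}
      (Φ : Cells f h P Q) (ψ : Cell g k Q r) (Ξ : Cells₂ h f' k g' P' Q' R) :
      Cells₂ f f' g g' (P.append P') (Q.append Q') (Chain.cons r R)

namespace Cells₂

variable {X : Type u} [Category.{v} X] [HasComp.{w, z} X]

/-- The juxtaposition `Φ₁, …, Φₙ` of the top rows. -/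
def top {A₀ A₁ B₀ B₁ C₀ C₁ : X}
    {f : A₀ ⟶ B₀} {f' : A₁ ⟶ B₁} {g : B₀ ⟶ C₀} {g' : B₁ ⟶ C₁}
    {P : Chain A₁ A₀} {Q : Chain B₁ B₀} {R : Chain C₁ C₀} :
    Cells₂ f f' g g' P Q R → Cells f f' P Q
  | nil f _ => Cells.nil f
  | cons Φ _ Ξ => Φ.append (top Ξ)

/-- The bottom row `ψ₁, …, ψₙ`. -/
def bottom {A₀ A₁ B₀ B₁ C₀ C₁ : X}
    {f : A₀ ⟶ B₀} {f' : A₁ ⟶ B₁} {g : B₀ ⟶ C₀} {g' : B₁ ⟶ C₁}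
    {P : Chain A₁ A₀} {Q : Chain B₁ B₀} {R : Chain C₁ C₀} :
    Cells₂ f f' g g' P Q R → Cells g g' Q R
  | nil _ g => Cells.nil g
  | cons _ ψ Ξ => Cells.cons ψ (bottom Ξ) rfl

/-- The row of the composites of `Φᵢ` with `ψᵢ`. -/
def composite {A₀ A₁ B₀ B₁ C₀ C₁ : X}
    {f : A₀ ⟶ B₀} {f' : A₁ ⟶ B₁} {g : B₀ ⟶ C₀} {g' : B₁ ⟶ C₁}
    {P : Chain A₁ A₀} {Q : Chain B₁ B₀} {R : Chain C₁ C₀} :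
    Cells₂ f f' g g' P Q R → Cells (f ≫ g) (f' ≫ g') P R
  | nil f g => Cells.nil (f ≫ g)
  | cons Φ ψ Ξ => Cells.cons (comp Φ ψ rfl rfl) (composite Ξ) rfl

end Cells₂

/-- A virtual double category, whose category of objects and tight-cells is `X`. -/
class VirtualDoubleCategory (X : Type u) [Category.{v} X] extends HasComp.{w, z} X where
  ids_comp {B₀ B₁ C₀ C₁ : X} {g : B₀ ⟶ C₀} {g' : B₁ ⟶ C₁} {Q : Chain B₁ B₀} {r : Loose C₁ C₀}
    (ψ : Cell g g' Q r) :
    comp (Cells.ids Q) ψ (Category.id_comp g) (Category.id_comp g') = ψ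
  comp_idCell {A₀ A₁ B₀ B₁ : X} {f : A₀ ⟶ B₀} {f' : A₁ ⟶ B₁} {P : Chain A₁ A₀} {q : Loose B₁ B₀}
    (φ : Cell f f' P q) :
    comp (Cells.single φ) (idCell q) (Category.comp_id f) (Category.comp_id f') = φ
  assoc {A₀ A₁ B₀ B₁ C₀ C₁ D₀ D₁ : X} {f : A₀ ⟶ B₀} {f' : A₁ ⟶ B₁} {g : B₀ ⟶ C₀} {g' : B₁ ⟶ C₁}
    {h : C₀ ⟶ D₀} {h' : C₁ ⟶ D₁} {P : Chain A₁ A₀} {Q : Chain B₁ B₀} {R : Chain C₁ C₀}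
    {s : Loose D₁ D₀} (Ξ : Cells₂ f f' g g' P Q R) (χ : Cell h h' R s) :
    comp Ξ.composite χ (Category.assoc f g h) (Category.assoc f' g' h') =
      comp Ξ.top (comp Ξ.bottom χ rfl rfl) rfl rfl

section VirtualDoubleCategory

variable {X : Type u} [Category.{v} X] [VirtualDoubleCategory.{w, z} X]

/-- Cartesian 2-cells. -/
def IsCartesian {A₀ A₁ B₀ B₁ : X} {f : A₀ ⟶ B₀} {g : A₁ ⟶ B₁} {p : Loose A₁ A₀} {q : Loose B₁ B₀}
    (κ : Cell f g (Chain.single p) q) : Prop :=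
  ∀ ⦃Z₀ Z₁ : X⦄ (f' : Z₀ ⟶ A₀) (g' : Z₁ ⟶ A₁) (R : Chain Z₁ Z₀) (φ : Cell (f' ≫ f) (g' ≫ g) R q),
    ∃! ψ : Cell f' g' R p, comp (Cells.single ψ) κ rfl rfl = φ

/-- The row `=, κ, =` obtained by juxtaposing a globular 2-cell with identities on both sides. -/
def Cells.whisker {A B Y Z : X} {Q : Chain B A} {q : Loose B A} (P : Chain A Z)
    (κ : Cell (𝟙 A) (𝟙 B) Q q) (R : Chain Y B) :
    Cells (𝟙 Z) (𝟙 Y) (P.append (Q.append R)) (P.append (Chain.cons q R)) :=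
  (Cells.ids P).append (Cells.cons κ (Cells.ids R) rfl)

/-- Opcartesian 2-cells. -/
def IsOpcartesian {A B : X} {Q : Chain B A} {q : Loose B A} (κ : Cell (𝟙 A) (𝟙 B) Q q) : Prop :=
  ∀ ⦃Y Z C₀ C₁ : X⦄ (P : Chain A Z) (R : Chain Y B) (f : Z ⟶ C₀) (g : Y ⟶ C₁) (s : Loose C₁ C₀)
    (φ : Cell f g (P.append (Q.append R)) s),
    ∃! ψ : Cell f g (P.append (Chain.cons q R)) s,
      comp (Cells.whisker P κ R) ψ (Category.id_comp f) (Category.id_comp g) = φ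

/-- Composition of globular 2-cells between loose-cells. -/
def vcomp {A B : X} {p q r : Loose B A} (φ : Cell (𝟙 A) (𝟙 B) (Chain.single p) q)
    (ψ : Cell (𝟙 A) (𝟙 B) (Chain.single q) r) : Cell (𝟙 A) (𝟙 B) (Chain.single p) r :=
  comp (Cells.single φ) ψ (Category.id_comp _) (Category.id_comp _)

/-- Invertibility of a globular 2-cell between loose-cells. -/
def IsInvertible {A B : X} {p q : Loose B A} (φ : Cell (𝟙 A) (𝟙 B) (Chain.single p) q) : Prop :=
  ∃ ψ : Cell (𝟙 A) (𝟙 B) (Chain.single q) p, vcomp φ ψ = idCell p ∧ vcomp ψ φ = idCell q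

/-- Loose-cells `p` and `q` are isomorphic, `p ≅ q`. -/
def LooseIso {A B : X} (p q : Loose B A) : Prop :=
  ∃ φ : Cell (𝟙 A) (𝟙 B) (Chain.single p) q, IsInvertible φ

/-- The 2-cell `ϖ : p₁, …, pₘ, l ⇒ q` exhibits `l` as the right lift of `q` through `p₁, …, pₘ`. -/
def IsRightLift {W Y Z : X} (P : Chain Y Z) {q : Loose W Z} {l : Loose W Y}
    (ϖ : Cell (𝟙 Z) (𝟙 W) (P.append (Chain.single l)) q) : Prop :=
  ∀ (R : Chain W Y) (φ : Cell (𝟙 Z) (𝟙 W) (P.append R) q),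
    ∃! ψ : Cell (𝟙 Y) (𝟙 W) R l,
      comp ((Cells.ids P).append (Cells.single ψ)) ϖ (Category.id_comp _) (Category.id_comp _) = φ

end VirtualDoubleCategory

/-- A virtual equipment: a virtual double category with a choice of loose-identities `A(1, 1)` and
of restrictions `q(f, g)`. (The choice of restrictions need not be strictly functorial.) -/
class VirtualEquipment (X : Type u) [Category.{v} X] extends VirtualDoubleCategory.{w, z} X where
  unit (A : X) : Loose A A
  unitCell (A : X) : Cell (𝟙 A) (𝟙 A) Chain.nil (unit A)
  isOpcartesian_unitCell (A : X) : IsOpcartesian (X := X) (unitCell A)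
  res {A₀ A₁ B₀ B₁ : X} (q : Loose B₁ B₀) (f : A₀ ⟶ B₀) (g : A₁ ⟶ B₁) : Loose A₁ A₀
  cart {A₀ A₁ B₀ B₁ : X} (q : Loose B₁ B₀) (f : A₀ ⟶ B₀) (g : A₁ ⟶ B₁) :
    Cell f g (Chain.single (res q f g)) q
  isCartesian_cart {A₀ A₁ B₀ B₁ : X} (q : Loose B₁ B₀) (f : A₀ ⟶ B₀) (g : A₁ ⟶ B₁) :
    IsCartesian (X := X) (cart q f g)

open VirtualEquipment

section VirtualEquipment

variable {X : Type u} [Category.{v} X] [VirtualEquipment.{w, z} X]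

/-- The restriction `B(f, g)` of the loose-identity of `B`. -/
abbrev hom {A₀ A₁ B : X} (f : A₀ ⟶ B) (g : A₁ ⟶ B) : Loose A₁ A₀ := res (unit B) f g

/-- The conjoint `B(f, 1)` of `f`. -/
abbrev conjoint {A B : X} (f : A ⟶ B) : Loose B A := hom f (𝟙 B)

/-- The companion `B(1, f)` of `f`. -/
abbrev companion {A B : X} (f : A ⟶ B) : Loose A B := hom (𝟙 B) f

/-- The factorisation of a 2-cell through the cartesian 2-cell of a restriction. -/
noncomputable def factor {A₀ A₁ B₀ B₁ Z₀ Z₁ : X} (q : Loose B₁ B₀) (f : A₀ ⟶ B₀) (g : A₁ ⟶ B₁)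
    (f' : Z₀ ⟶ A₀) (g' : Z₁ ⟶ A₁) {R : Chain Z₁ Z₀} {k : Z₀ ⟶ B₀} {k' : Z₁ ⟶ B₁}
    (φ : Cell k k' R q) (e : f' ≫ f = k) (e' : g' ≫ g = k') : Cell f' g' R (res q f g) :=
  (isCartesian_cart q f g f' g' R (e ▸ e' ▸ φ)).exists.choose

theorem factor_comp_cart {A₀ A₁ B₀ B₁ Z₀ Z₁ : X} (q : Loose B₁ B₀) (f : A₀ ⟶ B₀) (g : A₁ ⟶ B₁)
    (f' : Z₀ ⟶ A₀) (g' : Z₁ ⟶ A₁) {R : Chain Z₁ Z₀} {k : Z₀ ⟶ B₀} {k' : Z₁ ⟶ B₁}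
    (φ : Cell k k' R q) (e : f' ≫ f = k) (e' : g' ≫ g = k') :
    comp (Cells.single (factor q f g f' g' φ e e')) (cart q f g) e e' = φ := by
  subst e e'
  exact (isCartesian_cart q f g f' g' R φ).exists.choose_spec

/-- The unitor `X(1, 1), p ⇒ p`: the 2-cell that yields the identity on `p` when precomposed with
the opcartesian 2-cell of the loose-identity. -/
noncomputable def leftUnitor {A W : X} (p : Loose W A) :
    Cell (𝟙 A) (𝟙 W) (Chain.cons (unit A) (Chain.single p)) p :=
  (isOpcartesian_unitCell A Chain.nil (Chain.single p) (𝟙 A) (𝟙 W) p (idCell p)).exists.choose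

theorem leftUnitor_spec {A W : X} (p : Loose W A) :
    comp (Cells.whisker Chain.nil (unitCell A) (Chain.single p)) (leftUnitor p)
      (Category.id_comp _) (Category.id_comp _) = idCell p :=
  (isOpcartesian_unitCell A Chain.nil (Chain.single p) (𝟙 A) (𝟙 W) p
    (idCell p)).exists.choose_spec

/-- The identity `f ⇒ f` on a tight-cell, as a nullary 2-cell with loose-identity codomain. -/
def tightId {A B : X} (f : A ⟶ B) : Cell f f Chain.nil (unit B) :=
  comp (Cells.nil f) (unitCell B) (Category.comp_id f) (Category.comp_id f)

/-- The composite of 2-cells `f ⇒ g` and `g ⇒ h` between tight-cells. -/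
noncomputable def tightComp {A B : X} {f g h : A ⟶ B} (α : Cell f g Chain.nil (unit B))
    (β : Cell g h Chain.nil (unit B)) : Cell f h Chain.nil (unit B) :=
  comp (Cells.cons α (Cells.single β) rfl) (leftUnitor (unit B))
    (Category.comp_id f) (Category.comp_id h)

/-- Invertibility of a 2-cell between tight-cells. -/
def IsTightInvertible {A B : X} {f g : A ⟶ B} (α : Cell f g Chain.nil (unit B)) : Prop :=
  ∃ β : Cell g f Chain.nil (unit B), tightComp α β = tightId f ∧ tightComp β α = tightId g

/-- Tight-cells `f` and `g` are isomorphic, `f ≅ g`. -/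
def TightIso {A B : X} (f g : A ⟶ B) : Prop :=
  ∃ α : Cell f g Chain.nil (unit B), IsTightInvertible α

/-- The action `A(1, 1) ⇒ B(1, 1)` of a tight-cell `g : A ⟶ B` on loose-identities: the 2-cell that
yields the identity `g ⇒ g` when precomposed with the opcartesian 2-cell of `A(1, 1)`. -/
noncomputable def unitMap {A B : X} (g : A ⟶ B) : Cell g g (Chain.single (unit A)) (unit B) :=
  (isOpcartesian_unitCell A Chain.nil Chain.nil g g (unit B) (tightId g)).exists.choose

theorem unitMap_spec {A B : X} (g : A ⟶ B) :
    comp (Cells.whisker Chain.nil (unitCell A) Chain.nil) (unitMap g)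
      (Category.id_comp _) (Category.id_comp _) = tightId g :=
  (isOpcartesian_unitCell A Chain.nil Chain.nil g g (unit B) (tightId g)).exists.choose_spec

/-! ### Weighted colimits -/

/-- The 2-cell part of a `P`-weighted cocone `(c, γ)` for `f`, i.e. a 2-cell `γ : P ⇒ B(f, c)`. -/
abbrev Cocone {Y Z B : X} (P : Chain Y Z) (f : Z ⟶ B) (c : Y ⟶ B) :=
  Cell (𝟙 Z) (𝟙 Y) P (hom f c)

/-- For a cocone `γ : P ⇒ B(f, c)` and a loose-cell `p` into `B`, the canonical 2-cell
`P, p(c, 1) ⇒ p(f, 1)`. Its composite with the cartesian 2-cell `p(f, 1) ⇒ p` is obtained by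
pasting `γ`, the cartesian 2-cells `B(f, c) ⇒ B(1, 1)` and `p(c, 1) ⇒ p`, and the unitor
`B(1, 1), p ⇒ p`. -/
noncomputable def act {Y Z B W : X} {P : Chain Y Z} {f : Z ⟶ B} {c : Y ⟶ B}
    (γ : Cocone P f c) (p : Loose W B) :
    Cell (𝟙 Z) (𝟙 W) (P.append (Chain.single (res p c (𝟙 W)))) (res p f (𝟙 W)) :=
  factor p f (𝟙 W) (𝟙 Z) (𝟙 W)
    (comp
      (Cells.cons
        (comp (Cells.single γ) (cart (unit B) f c) (Category.id_comp f) (Category.id_comp c))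
        (Cells.single (cart p c (𝟙 W))) rfl)
      (leftUnitor p) (Category.comp_id f) (Category.comp_id (𝟙 W)))
    (Category.id_comp f) (Category.id_comp (𝟙 W))

/-- The cocone `(c, γ)` is colimiting: the 2-cell `P, B(c, 1) ⇒ B(f, 1)` exhibits `B(c, 1)` as the
right lift of `B(f, 1)` through `P`. -/
def IsColimit {Y Z B : X} {P : Chain Y Z} {f : Z ⟶ B} {c : Y ⟶ B} (γ : Cocone P f c) : Prop :=
  IsRightLift P (act γ (unit B))

/-- `B` admits the `P`-weighted colimit of `f`. -/
def HasColimit {Y Z B : X} (P : Chain Y Z) (f : Z ⟶ B) : Prop :=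
  ∃ (c : Y ⟶ B) (γ : Cocone P f c), IsColimit γ

/-- The cocone `((c ≫ g), (γ ≫ g))` for `f ≫ g`. -/
noncomputable def Cocone.map {Y Z B B' : X} {P : Chain Y Z} {f : Z ⟶ B} {c : Y ⟶ B}
    (γ : Cocone P f c) (g : B ⟶ B') : Cocone P (f ≫ g) (c ≫ g) :=
  factor (unit B') (f ≫ g) (c ≫ g) (𝟙 Z) (𝟙 Y)
    (comp
      (Cells.single
        (comp (Cells.single γ) (cart (unit B) f c) (Category.id_comp f) (Category.id_comp c)))
      (unitMap g) rfl rfl)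
    (Category.id_comp _) (Category.id_comp _)

/-- The loose-cell `p` (whose codomain contains the colimit) respects the colimit `(c, γ)`: the canonical 2-cell `P, p(c, 1) ⇒ p(f, 1)`
exhibits `p(c, 1)` as the right lift of `p(f, 1)` through `P`. -/
def Respects {Y Z B W : X} {P : Chain Y Z} {f : Z ⟶ B} {c : Y ⟶ B} (p : Loose W B)
    (γ : Cocone P f c) : Prop :=
  IsRightLift P (act γ p)

/-- The (pointwise) left extension of `f` along `j` exists. -/
def HasLeftExtension {Y Z B : X} (j : Z ⟶ Y) (f : Z ⟶ B) : Prop :=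
  HasColimit (Chain.single (conjoint j)) f

/-- The canonical nullary 2-cell into the conjoint `Y(j, 1)`, with left-hand side `1` and
right-hand side `j`. -/
noncomputable def conjointUnit {Y Z : X} (j : Z ⟶ Y) :
    Cell (𝟙 Z) j Chain.nil (conjoint j) :=
  factor (unit Y) j (𝟙 Y) (𝟙 Z) j (tightId j) (Category.id_comp j) (Category.comp_id j)

/-- The unit `f ⇒ j ≫ l` of a left extension `l` of `f` along `j`. -/
noncomputable def extensionUnit {Y Z B : X} {j : Z ⟶ Y} {f : Z ⟶ B} {l : Y ⟶ B}
    (γ : Cocone (Chain.single (conjoint j)) f l) : Cell f (j ≫ l) Chain.nil (unit B) :=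
  comp (Cells.single (conjointUnit j))
    (comp (Cells.single γ) (cart (unit B) f l) (Category.id_comp f) (Category.id_comp l))
    (Category.id_comp f) rfl

/-- The 2-cell `l(j, 1) ⇒ p` induced by a 2-cell `ϖ : E(j, 1), l ⇒ p`. -/
noncomputable def transpose {A E W : X} {j : A ⟶ E} {p : Loose W A} {l : Loose W E}
    (ϖ : Cell (𝟙 A) (𝟙 W) ((Chain.single (conjoint j)).append (Chain.single l)) p) :
    Cell (𝟙 A) (𝟙 W) (Chain.single (res l j (𝟙 W))) p :=
  comp (Cells.cons (conjointUnit j) (Cells.single (cart l j (𝟙 W))) rfl) ϖ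
    (Category.id_comp _) (Category.id_comp _)

/-! ### Adjunctions and reflections -/

/-- `l` is left adjoint to `r`, i.e. `A(l, 1) ≅ B(1, r)`. -/
def IsLeftAdjoint {A B : X} (l : B ⟶ A) (r : A ⟶ B) : Prop :=
  LooseIso (conjoint l) (companion r)

/-- `f` is fully faithful, i.e. `A(1, 1) ≅ B(f, f)`. -/
def IsFullyFaithful {A B : X} (f : A ⟶ B) : Prop :=
  LooseIso (unit A) (hom f f)

/-- `A` is reflective in `B`: there is an adjunction whose right adjoint is a fully faithful
tight-cell from `A` to `B`. -/
def IsReflectiveIn (A B : X) : Prop :=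
  ∃ (r : A ⟶ B) (l : B ⟶ A), IsFullyFaithful r ∧ IsLeftAdjoint l r

end VirtualEquipment

/-! ### Cocompleteness, saturation and cocompletions -/

/-- Classes of weights. -/
abbrev WeightClass (X : Type u) [HasLoose.{w} X] := ∀ Y Z : X, Set (Chain Y Z)

section Cocompleteness

variable {X : Type u} [Category.{v} X] [VirtualEquipment.{w, z} X]

/-- `A` is `Φ`-cocomplete: it admits all colimits weighted by weights in `Φ`. -/
def IsCocomplete (Φ : WeightClass X) (A : X) : Prop :=
  ∀ ⦃W D : X⦄ (P : Chain W D), P ∈ Φ W D → ∀ f : D ⟶ A, HasColimit P f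

/-- `g` preserves every `Φ`-colimit. -/
def IsCocontinuous (Φ : WeightClass X) {A B : X} (g : A ⟶ B) : Prop :=
  ∀ ⦃W D : X⦄ (P : Chain W D), P ∈ Φ W D → ∀ (f : D ⟶ A) (c : W ⟶ A) (γ : Cocone P f c),
    IsColimit γ → IsColimit (γ.map g)

/-- `p` respects every `Φ`-colimit. -/
def IsExact (Φ : WeightClass X) {A V : X} (p : Loose V A) : Prop :=
  ∀ ⦃W D : X⦄ (P : Chain W D), P ∈ Φ W D → ∀ (f : D ⟶ A) (c : W ⟶ A) (γ : Cocone P f c),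
    IsColimit γ → Respects p γ

/-- The preorder on classes of weights defining colimit equivalence. -/
structure ColimitLE (Φ Φ' : WeightClass X) : Prop where
  cocomplete : ∀ A : X, IsCocomplete Φ' A → IsCocomplete Φ A
  cocontinuous : ∀ ⦃A B : X⦄ (g : A ⟶ B), IsCocomplete Φ' A → IsCocontinuous Φ' g →
    IsCocontinuous Φ g
  exact : ∀ ⦃V A : X⦄ (p : Loose V A), IsCocomplete Φ' A → IsExact Φ' p → IsExact Φ p

/-- Colimit equivalence of classes of weights. -/
def ColimitEquiv (Φ Φ' : WeightClass X) : Prop := ColimitLE Φ Φ' ∧ ColimitLE Φ' Φ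

/-- The colimit saturation: the largest class of weights colimit equivalent to `Φ`
(see `isGreatest_saturation`). -/
def saturation (Φ : WeightClass X) : WeightClass X :=
  fun Y Z => {P | ∃ Ψ : WeightClass X, ColimitEquiv Ψ Φ ∧ P ∈ Ψ Y Z}

theorem isGreatest_saturation (Φ : WeightClass X) :
    IsGreatest {Ψ : WeightClass X | ColimitEquiv Ψ Φ} (saturation Φ) := by
  have hrefl : ColimitEquiv Φ Φ :=
    ⟨⟨fun _ h => h, fun _ _ _ _ h => h, fun _ _ _ _ h => h⟩,
      ⟨fun _ h => h, fun _ _ _ _ h => h, fun _ _ _ _ h => h⟩⟩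
  have hc : ∀ A : X, IsCocomplete (saturation Φ) A → IsCocomplete Φ A :=
    fun A h W D P hP => h P ⟨Φ, hrefl, hP⟩
  refine ⟨⟨⟨?_, ?_, ?_⟩, ⟨hc, ?_, ?_⟩⟩, fun Ψ hΨ Y Z P hP => ⟨Ψ, hΨ, hP⟩⟩
  · rintro A h W D P ⟨Ψ, hΨ, hP⟩
    exact hΨ.1.cocomplete A h P hP
  · rintro A B g hA h W D P ⟨Ψ, hΨ, hP⟩
    exact hΨ.1.cocontinuous g hA h P hP
  · rintro V A p hA h W D P ⟨Ψ, hΨ, hP⟩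
    exact hΨ.1.exact p hA h P hP
  · exact fun A B g _ h W D P hP => h P ⟨Φ, hrefl, hP⟩
  · exact fun V A p _ h W D P hP => h P ⟨Φ, hrefl, hP⟩

/-- The tight-cell `j : A ⟶ E` exhibits `E` as a `Φ`-cocompletion of `A`. -/
structure IsCocompletion (Φ : WeightClass X) {A E : X} (j : A ⟶ E) : Prop where
  cocomplete : IsCocomplete Φ E
  /-- The left extension `l` of `f` along `j` exists, has invertible unit, and is the essentially
  unique `Φ`-cocontinuous tight-cell such that `f ≅ j ≫ l`. -/
  tight : ∀ ⦃B : X⦄ (f : A ⟶ B), IsCocomplete Φ B →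
    ∃ (l : E ⟶ B) (γ : Cocone (Chain.single (conjoint j)) f l),
      IsColimit γ ∧ IsTightInvertible (extensionUnit γ) ∧ IsCocontinuous Φ l ∧
      ∀ l' : E ⟶ B, IsCocontinuous Φ l' → TightIso f (j ≫ l') → TightIso l' l
  /-- The right lift `l` of `p` through `E(j, 1)` exists, the canonical 2-cell `l(j, 1) ⇒ p` is
  invertible, and `l` is the essentially unique `Φ`-exact loose-cell such that `p ≅ l(j, 1)`. -/
  loose : ∀ ⦃W : X⦄ (p : Loose W A),
    ∃ (l : Loose W E)
      (ϖ : Cell (𝟙 A) (𝟙 W) ((Chain.single (conjoint j)).append (Chain.single l)) p),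
      IsRightLift (Chain.single (conjoint j)) ϖ ∧ IsInvertible (transpose ϖ) ∧ IsExact Φ l ∧
      ∀ l' : Loose W E, IsExact Φ l' → LooseIso p (res l' j (𝟙 W)) → LooseIso l' l

end Cocompleteness

end VDC

namespace VDC

open HasLoose HasCells HasComp VirtualEquipment

/-! ### The calculus of rows -/

namespace Cells

section Append

variable {X : Type u} [Category.{v} X] [HasCells.{w, z} X]

/-! A reflective object inherits colimits: if `r : A ⟶ B` is fully faithful with left adjoint `l`,
and `c` is the colimit of `f ≫ r` in `B`, then `A(c ≫ l, 1) ≅ B(c, r)` and `A(1, 1) ≅ B(r, r)`, so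
the universal property of `c`, tested against `r`, says that `c ≫ l` is the colimit of `f`
(`HasColimit.of_reflective`). Since every object is reflective in itself, this settles (1) ⇔ (2).

For a cocompletion `j : A ⟶ E`, the crux is the passage from a left extension `c` of the identity to
a left adjoint of `j`. By definition `A(c, 1)` is the right lift of `A(1, 1)` through `E(j, 1)`, and
the loose universal property characterises this lift as the unique exact loose-cell whose
restriction along `j` is `A(1, 1)`. The companion `E(1, j)` is another candidate: companions respect
all colimits, and its restriction along `j` is `E(j, j)`, which is `A(1, 1)` once `j` is known to be
fully faithful. Hence `A(c, 1) ≅ E(1, j)`.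

Full faithfulness (`IsCocompletion.isFullyFaithful`) also comes from the loose universal property.
Applied to `E(j, j)`, it shows that `E(1, j)` is the right lift of `E(j, j)` through `E(j, 1)`, a
density statement. Applied to `A(1, 1)`, it provides a lift `l` from which an inverse of `A(1, 1) ⇒
E(j, j)` is built, density being used to verify one of the two equations.

For (5), the `P`-colimit of `f` is the colimit of the identity weighted by `A(1, f), P`, and
adjoining such weights to `Φ` does not change its notions of cocompleteness, cocontinuity and
exactness (`companion_cons_mem_saturation`).

Throughout, right lifts and colimits are rephrased as bijectivity of an action `dot` on 2-cells
(`respects_iff`), and companions and conjoints at the ends of a chain are traded for tight-cells in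
the frame. -/

theorem cons_heq {A₀ A₁ A₂ B₀ B₁ B₂ : X} {f : A₀ ⟶ B₀} {h : A₁ ⟶ B₁} {f' : A₂ ⟶ B₂}
    {P : Chain A₁ A₀} {P' P'' : Chain A₂ A₁} {R R' : Chain A₂ A₀} {q : Loose B₁ B₀}
    {Q Q' : Chain B₂ B₁} (φ : Cell f h P q) {Φ : Cells h f' P' Q} {Φ' : Cells h f' P'' Q'}
    (e : P.append P' = R) (e' : P.append P'' = R') (hP : P' = P'') (hQ : Q = Q')
    (hΦ : HEq Φ Φ') : HEq (cons φ Φ e) (cons φ Φ' e') := by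
  subst hP hQ e e'
  cases hΦ
  rfl

theorem append_nil_heq {A₀ A₁ B₀ B₁ : X} {f : A₀ ⟶ B₀} {f' : A₁ ⟶ B₁} {P : Chain A₁ A₀}
    {Q : Chain B₁ B₀} (Φ : Cells f f' P Q) : HEq (Φ.append (nil f')) Φ := by
  induction Φ with
  | nil f => rfl
  | cons φ Φ e ih => exact cons_heq φ _ _ (Chain.append_nil _) (Chain.append_nil _) ih

/-- Heterogeneous equality is forced here: concatenation of chains is associative only
propositionally, so the two rows have different types. -/
theorem append_assoc_heq {A₀ A₁ A₂ A₃ B₀ B₁ B₂ B₃ : X} {f : A₀ ⟶ B₀} {g : A₁ ⟶ B₁}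
    {h : A₂ ⟶ B₂} {k : A₃ ⟶ B₃} {P : Chain A₁ A₀} {P' : Chain A₂ A₁} {P'' : Chain A₃ A₂}
    {Q : Chain B₁ B₀} {Q' : Chain B₂ B₁} {Q'' : Chain B₃ B₂}
    (Φ : Cells f g P Q) (Ψ : Cells g h P' Q') (Θ : Cells h k P'' Q'') :
    HEq ((Φ.append Ψ).append Θ) (Φ.append (Ψ.append Θ)) := by
  induction Φ with
  | nil f => rfl
  | cons φ Φ e ih =>
    exact cons_heq φ _ _ (Chain.append_assoc _ _ _) (Chain.append_assoc _ _ _) (ih Ψ)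

/-- Juxtaposition of rows, with concatenations allowed to hold only propositionally. -/
def cat {A₀ A₁ A₂ B₀ B₁ B₂ : X} {f : A₀ ⟶ B₀} {h : A₁ ⟶ B₁} {f' : A₂ ⟶ B₂}
    {P : Chain A₁ A₀} {P' : Chain A₂ A₁} {Q : Chain B₁ B₀} {Q' : Chain B₂ B₁}
    {S : Chain A₂ A₀} {T : Chain B₂ B₀} (Φ : Cells f h P Q) (Ψ : Cells h f' P' Q')
    (e : P.append P' = S) (e' : Q.append Q' = T) : Cells f f' S T :=
  e ▸ e' ▸ Φ.append Ψ

theorem cat_heq {A₀ A₁ A₂ B₀ B₁ B₂ : X} {f : A₀ ⟶ B₀} {h : A₁ ⟶ B₁} {f' : A₂ ⟶ B₂}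
    {P : Chain A₁ A₀} {P' : Chain A₂ A₁} {Q : Chain B₁ B₀} {Q' : Chain B₂ B₁}
    {S : Chain A₂ A₀} {T : Chain B₂ B₀} (Φ : Cells f h P Q) (Ψ : Cells h f' P' Q')
    (e : P.append P' = S) (e' : Q.append Q' = T) : HEq (cat Φ Ψ e e') (Φ.append Ψ) := by
  subst e e'
  rfl

theorem cat_nil {A₀ A₁ B₀ B₁ : X} {f : A₀ ⟶ B₀} {f' : A₁ ⟶ B₁} {P : Chain A₁ A₀}
    {Q : Chain B₁ B₀} (Φ : Cells f f' P Q) (e : P.append Chain.nil = P)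
    (e' : Q.append Chain.nil = Q) : cat Φ (nil f') e e' = Φ :=
  eq_of_heq ((cat_heq _ _ _ _).trans (append_nil_heq Φ))

theorem append_append_eq_cat {A₀ A₁ A₂ A₃ B₀ B₁ B₂ B₃ : X} {f : A₀ ⟶ B₀} {g : A₁ ⟶ B₁}
    {h : A₂ ⟶ B₂} {k : A₃ ⟶ B₃} {P : Chain A₁ A₀} {P' : Chain A₂ A₁} {P'' : Chain A₃ A₂}
    {Q : Chain B₁ B₀} {Q' : Chain B₂ B₁} {Q'' : Chain B₃ B₂}
    (Φ : Cells f g P Q) (Ψ : Cells g h P' Q') (Θ : Cells h k P'' Q'') :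
    (Φ.append Ψ).append Θ = cat Φ (Ψ.append Θ) (Chain.append_assoc _ _ _).symm
      (Chain.append_assoc _ _ _).symm :=
  eq_of_heq ((append_assoc_heq Φ Ψ Θ).trans (cat_heq _ _ _ _).symm)

end Append

section Comp

variable {X : Type u} [Category.{v} X] [HasComp.{w, z} X]

theorem ids_nil (A : X) : ids (Chain.nil : Chain A A) = nil (𝟙 A) := by
  rw [ids]

theorem ids_cons {X₀ X₁ Y : X} (p : Loose X₁ X₀) (P : Chain Y X₁) :
    ids (Chain.cons p P) = cons (idCell p) (ids P) rfl :=
  ids.eq_2 _ _ _ P p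

theorem ids_single {A B : X} (p : Loose A B) : ids (Chain.single p) = single (idCell p) := by
  rw [ids_cons, ids_nil]
  rfl

theorem ids_append {V Y : X} : {Z : X} → (P : Chain Y Z) → (Q : Chain V Y) →
    ids (P.append Q) = (ids P).append (ids Q)
  | _, Chain.nil, Q => by
    rw [ids_nil]
    rfl
  | _, Chain.cons p P, Q => by
    change ids (Chain.cons p (P.append Q)) = _
    rw [ids_cons, ids_cons, ids_append P Q]
    rfl

/-- `IsComp Φ Ψ Θ` means that the row `Θ` is the vertical composite of the rows `Φ` and `Ψ`. -/
inductive IsComp : ∀ {A₀ A₁ B₀ B₁ C₀ C₁ : X} {f : A₀ ⟶ B₀} {f' : A₁ ⟶ B₁} {g : B₀ ⟶ C₀}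
    {g' : B₁ ⟶ C₁} {k : A₀ ⟶ C₀} {k' : A₁ ⟶ C₁} {P : Chain A₁ A₀} {Q : Chain B₁ B₀}
    {R : Chain C₁ C₀}, Cells f f' P Q → Cells g g' Q R → Cells k k' P R → Prop
  | nil {A B C : X} (f : A ⟶ B) (g : B ⟶ C) {k : A ⟶ C} (e : f ≫ g = k) :
      IsComp (Cells.nil f) (Cells.nil g) (Cells.nil k)
  | cons {A₀ A₁ A₂ B₀ B₁ B₂ C₀ C₁ C₂ : X} {f : A₀ ⟶ B₀} {h : A₁ ⟶ B₁} {f' : A₂ ⟶ B₂}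
      {g : B₀ ⟶ C₀} {m : B₁ ⟶ C₁} {g' : B₂ ⟶ C₂} {k : A₀ ⟶ C₀} {n : A₁ ⟶ C₁} {k' : A₂ ⟶ C₂}
      {P : Chain A₁ A₀} {P' : Chain A₂ A₁} {Q : Chain B₁ B₀} {Q' : Chain B₂ B₁}
      {r : Loose C₁ C₀} {R : Chain C₂ C₁} (Φ : Cells f h P Q) (ψ : Cell g m Q r)
      {Φ' : Cells h f' P' Q'} {Ψ' : Cells m g' Q' R} {Θ' : Cells n k' P' R}
      (H : IsComp Φ' Ψ' Θ') (e : f ≫ g = k) (e' : h ≫ m = n) :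
      IsComp (Φ.append Φ') (Cells.cons ψ Ψ' rfl) (Cells.cons (comp Φ ψ e e') Θ' rfl)

theorem IsComp.cons_cat {A₀ A₁ A₂ B₀ B₁ B₂ C₀ C₁ C₂ : X} {f : A₀ ⟶ B₀} {h : A₁ ⟶ B₁}
    {f' : A₂ ⟶ B₂} {g : B₀ ⟶ C₀} {m : B₁ ⟶ C₁} {g' : B₂ ⟶ C₂} {k : A₀ ⟶ C₀} {n : A₁ ⟶ C₁}
    {k' : A₂ ⟶ C₂} {P : Chain A₁ A₀} {P' : Chain A₂ A₁} {Q : Chain B₁ B₀} {Q' : Chain B₂ B₁}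
    {r : Loose C₁ C₀} {R : Chain C₂ C₁} {S : Chain A₂ A₀} {T : Chain B₂ B₀}
    (Φ : Cells f h P Q) (ψ : Cell g m Q r)
    {Φ' : Cells h f' P' Q'} {Ψ' : Cells m g' Q' R} {Θ' : Cells n k' P' R}
    (H : IsComp Φ' Ψ' Θ') (e : f ≫ g = k) (e' : h ≫ m = n)
    (eP : P.append P' = S) (eQ : Q.append Q' = T) :
    IsComp (cat Φ Φ' eP eQ) (Cells.cons ψ Ψ' eQ) (Cells.cons (comp Φ ψ e e') Θ' eP) := by
  subst eP eQ
  exact IsComp.cons Φ ψ H e e'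

theorem IsComp.single {A₀ A₁ B₀ B₁ C₀ C₁ : X} {f : A₀ ⟶ B₀} {f' : A₁ ⟶ B₁} {g : B₀ ⟶ C₀}
    {g' : B₁ ⟶ C₁} {k : A₀ ⟶ C₀} {k' : A₁ ⟶ C₁} {P : Chain A₁ A₀} {Q : Chain B₁ B₀}
    {r : Loose C₁ C₀} (Φ : Cells f f' P Q) (ψ : Cell g g' Q r) (e : f ≫ g = k)
    (e' : f' ≫ g' = k') : IsComp Φ (Cells.single ψ) (Cells.single (comp Φ ψ e e')) := by
  have := IsComp.cons_cat Φ ψ (IsComp.nil f' g' e') e e' P.append_nil Q.append_nil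
  rwa [cat_nil] at this

theorem IsComp.append {A₀ A₁ A₂ B₀ B₁ B₂ C₀ C₁ C₂ : X} {f : A₀ ⟶ B₀} {h : A₁ ⟶ B₁}
    {f' : A₂ ⟶ B₂} {g : B₀ ⟶ C₀} {m : B₁ ⟶ C₁} {g' : B₂ ⟶ C₂} {k : A₀ ⟶ C₀} {n : A₁ ⟶ C₁}
    {k' : A₂ ⟶ C₂} {P : Chain A₁ A₀} {P' : Chain A₂ A₁} {Q : Chain B₁ B₀} {Q' : Chain B₂ B₁}
    {R : Chain C₁ C₀} {R' : Chain C₂ C₁}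
    {Φ : Cells f h P Q} {Ψ : Cells g m Q R} {Θ : Cells k n P R}
    {Φ' : Cells h f' P' Q'} {Ψ' : Cells m g' Q' R'} {Θ' : Cells n k' P' R'}
    (H : IsComp Φ Ψ Θ) (H' : IsComp Φ' Ψ' Θ') :
    IsComp (Φ.append Φ') (Ψ.append Ψ') (Θ.append Θ') := by
  induction H with
  | nil f g e => exact H'
  | cons Φ ψ H e e' ih =>
    rw [append_append_eq_cat]
    exact IsComp.cons_cat Φ ψ (ih H') e e' _ _

theorem IsComp.cat {A₀ A₁ A₂ B₀ B₁ B₂ C₀ C₁ C₂ : X} {f : A₀ ⟶ B₀} {h : A₁ ⟶ B₁}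
    {f' : A₂ ⟶ B₂} {g : B₀ ⟶ C₀} {m : B₁ ⟶ C₁} {g' : B₂ ⟶ C₂} {k : A₀ ⟶ C₀} {n : A₁ ⟶ C₁}
    {k' : A₂ ⟶ C₂} {P : Chain A₁ A₀} {P' : Chain A₂ A₁} {Q : Chain B₁ B₀} {Q' : Chain B₂ B₁}
    {R : Chain C₁ C₀} {R' : Chain C₂ C₁} {S : Chain A₂ A₀} {T : Chain B₂ B₀} {U : Chain C₂ C₀}
    {Φ : Cells f h P Q} {Ψ : Cells g m Q R} {Θ : Cells k n P R}
    {Φ' : Cells h f' P' Q'} {Ψ' : Cells m g' Q' R'} {Θ' : Cells n k' P' R'}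
    (H : IsComp Φ Ψ Θ) (H' : IsComp Φ' Ψ' Θ')
    (eP : P.append P' = S) (eQ : Q.append Q' = T) (eR : R.append R' = U) :
    IsComp (Cells.cat Φ Φ' eP eQ) (Cells.cat Ψ Ψ' eQ eR) (Cells.cat Θ Θ' eP eR) := by
  subst eP eQ eR
  exact H.append H'

/-- The relation `IsComp` lets frames and chains agree only propositionally; this links it back to
the configurations for which the associativity axiom is stated. -/
theorem IsComp.exists_cells₂ {A₀ A₁ B₀ B₁ C₀ C₁ : X} {f : A₀ ⟶ B₀} {f' : A₁ ⟶ B₁} {g : B₀ ⟶ C₀}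
    {g' : B₁ ⟶ C₁} {k : A₀ ⟶ C₀} {k' : A₁ ⟶ C₁} {P : Chain A₁ A₀} {Q : Chain B₁ B₀}
    {R : Chain C₁ C₀} {Φ : Cells f f' P Q} {Ψ : Cells g g' Q R} {Θ : Cells k k' P R}
    (H : IsComp Φ Ψ Θ) :
    ∃ Ξ : Cells₂ f f' g g' P Q R, Ξ.top = Φ ∧ Ξ.bottom = Ψ ∧ ∃ (e : f ≫ g = k)
      (e' : f' ≫ g' = k'), (e ▸ e' ▸ Ξ.composite : Cells k k' P R) = Θ := by
  induction H with
  | nil f g e =>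
    subst e
    exact ⟨Cells₂.nil f g, rfl, rfl, rfl, rfl, rfl⟩
  | cons Φ ψ H e e' ih =>
    obtain ⟨Ξ, rfl, rfl, e₁, e₂, rfl⟩ := ih
    subst e e₁ e₂
    exact ⟨Cells₂.cons Φ ψ Ξ, rfl, rfl, rfl, rfl, rfl⟩

end Comp

section VirtualDoubleCategory

variable {X : Type u} [Category.{v} X] [VirtualDoubleCategory.{w, z} X]

theorem IsComp.ids_left {B₀ B₁ C₀ C₁ : X} {g : B₀ ⟶ C₀} {g' : B₁ ⟶ C₁} {Q : Chain B₁ B₀}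
    {R : Chain C₁ C₀} (Ψ : Cells g g' Q R) : IsComp (ids Q) Ψ Ψ := by
  induction Ψ with
  | nil f =>
    rw [ids_nil]
    exact IsComp.nil _ _ (Category.id_comp f)
  | cons ψ Ψ e ih =>
    subst e
    rw [ids_append]
    have := IsComp.cons (ids _) ψ ih (Category.id_comp _) (Category.id_comp _)
    rwa [VirtualDoubleCategory.ids_comp] at this

theorem IsComp.ids_right {A₀ A₁ B₀ B₁ : X} {f : A₀ ⟶ B₀} {f' : A₁ ⟶ B₁} {P : Chain A₁ A₀}
    {Q : Chain B₁ B₀} (Φ : Cells f f' P Q) : IsComp Φ (ids Q) Φ := by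
  induction Φ with
  | nil f =>
    rw [ids_nil]
    exact IsComp.nil _ _ (Category.comp_id f)
  | @cons A₀ A₁ A₂ B₀ B₁ B₂ f h f' P P' R q Q φ Φ e ih =>
    subst e
    have := IsComp.cons (Cells.single φ) (idCell q) ih (Category.comp_id _) (Category.comp_id _)
    rw [VirtualDoubleCategory.comp_idCell] at this
    rwa [ids_cons]

/-- The working form of associativity: all frame equations are free parameters, so no transport is
needed when it is applied. -/
theorem IsComp.comp_eq {A₀ A₁ B₀ B₁ C₀ C₁ D₀ D₁ : X} {f : A₀ ⟶ B₀} {f' : A₁ ⟶ B₁}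
    {g : B₀ ⟶ C₀} {g' : B₁ ⟶ C₁} {k : A₀ ⟶ C₀} {k' : A₁ ⟶ C₁} {h : C₀ ⟶ D₀} {h' : C₁ ⟶ D₁}
    {m : B₀ ⟶ D₀} {m' : B₁ ⟶ D₁} {n : A₀ ⟶ D₀} {n' : A₁ ⟶ D₁}
    {P : Chain A₁ A₀} {Q : Chain B₁ B₀} {R : Chain C₁ C₀} {s : Loose D₁ D₀}
    {Φ : Cells f f' P Q} {Ψ : Cells g g' Q R} {Θ : Cells k k' P R}
    (H : IsComp Φ Ψ Θ) (χ : Cell h h' R s) (e₁ : k ≫ h = n) (e₁' : k' ≫ h' = n')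
    (e₂ : f ≫ m = n) (e₂' : f' ≫ m' = n') (e₃ : g ≫ h = m) (e₃' : g' ≫ h' = m') :
    comp Θ χ e₁ e₁' = comp Φ (comp Ψ χ e₃ e₃') e₂ e₂' := by
  obtain ⟨Ξ, rfl, rfl, rfl, rfl, rfl⟩ := H.exists_cells₂
  subst e₂ e₂' e₃ e₃'
  exact VirtualDoubleCategory.assoc Ξ χ

end VirtualDoubleCategory

end Cells

section VirtualDoubleCategory

variable {X : Type u} [Category.{v} X] [VirtualDoubleCategory.{w, z} X]

theorem comp_heq {A₀ A₁ B₀ B₁ C₀ C₁ : X} {f : A₀ ⟶ B₀} {f' : A₁ ⟶ B₁} {g : B₀ ⟶ C₀}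
    {g' : B₁ ⟶ C₁} {k : A₀ ⟶ C₀} {k' : A₁ ⟶ C₁} {P P' : Chain A₁ A₀} {Q Q' : Chain B₁ B₀}
    {r : Loose C₁ C₀} {Φ : Cells f f' P Q} {Φ' : Cells f f' P' Q'} {ψ : Cell g g' Q r}
    {ψ' : Cell g g' Q' r} (e : f ≫ g = k) (e' : f' ≫ g' = k') (hP : P = P') (hQ : Q = Q')
    (hΦ : HEq Φ Φ') (hψ : HEq ψ ψ') : HEq (comp Φ ψ e e') (comp Φ' ψ' e e') := by
  subst hP hQ
  cases hΦ
  cases hψ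
  rfl

theorem comp_single_comp {A₀ A₁ B₀ B₁ C₀ C₁ D₀ D₁ : X} {f : A₀ ⟶ B₀} {f' : A₁ ⟶ B₁}
    {g : B₀ ⟶ C₀} {g' : B₁ ⟶ C₁} {k : A₀ ⟶ C₀} {k' : A₁ ⟶ C₁} {h : C₀ ⟶ D₀} {h' : C₁ ⟶ D₁}
    {m : B₀ ⟶ D₀} {m' : B₁ ⟶ D₁} {n : A₀ ⟶ D₀} {n' : A₁ ⟶ D₁}
    {P : Chain A₁ A₀} {Q : Chain B₁ B₀} {r : Loose C₁ C₀} {s : Loose D₁ D₀}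
    (Φ : Cells f f' P Q) (ψ : Cell g g' Q r) (χ : Cell h h' (Chain.single r) s)
    (e₀ : f ≫ g = k) (e₀' : f' ≫ g' = k') (e₁ : k ≫ h = n) (e₁' : k' ≫ h' = n')
    (e₂ : f ≫ m = n) (e₂' : f' ≫ m' = n') (e₃ : g ≫ h = m) (e₃' : g' ≫ h' = m') :
    comp (Cells.single (comp Φ ψ e₀ e₀')) χ e₁ e₁' =
      comp Φ (comp (Cells.single ψ) χ e₃ e₃') e₂ e₂' :=
  (Cells.IsComp.single Φ ψ e₀ e₀').comp_eq χ _ _ _ _ _ _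

theorem comp_single_idCell {A₀ A₁ B₀ B₁ : X} {f : A₀ ⟶ B₀} {f' : A₁ ⟶ B₁} {P : Chain A₁ A₀}
    {q : Loose B₁ B₀} (φ : Cell f f' P q) (e : f ≫ 𝟙 B₀ = f) (e' : f' ≫ 𝟙 B₁ = f') :
    comp (Cells.single φ) (idCell q) e e' = φ :=
  VirtualDoubleCategory.comp_idCell φ

theorem comp_ids {B₀ B₁ C₀ C₁ : X} {g : B₀ ⟶ C₀} {g' : B₁ ⟶ C₁} {Q : Chain B₁ B₀}
    {r : Loose C₁ C₀} (ψ : Cell g g' Q r) (e : 𝟙 B₀ ≫ g = g) (e' : 𝟙 B₁ ≫ g' = g') :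
    comp (Cells.ids Q) ψ e e' = ψ :=
  VirtualDoubleCategory.ids_comp ψ

theorem idCell_comp {B₀ B₁ C₀ C₁ : X} {g : B₀ ⟶ C₀} {g' : B₁ ⟶ C₁} {q : Loose B₁ B₀}
    {r : Loose C₁ C₀} (ψ : Cell g g' (Chain.single q) r) (e : 𝟙 B₀ ≫ g = g)
    (e' : 𝟙 B₁ ≫ g' = g') : comp (Cells.single (idCell q)) ψ e e' = ψ := by
  rw [← Cells.ids_single]
  exact comp_ids ψ e e'

theorem Cells.append_cat {A₀ A₁ A₂ A₃ B₀ B₁ B₂ B₃ : X} {f : A₀ ⟶ B₀} {g : A₁ ⟶ B₁}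
    {h : A₂ ⟶ B₂} {k : A₃ ⟶ B₃} {P : Chain A₁ A₀} {P' : Chain A₂ A₁} {P'' : Chain A₃ A₂}
    {Q : Chain B₁ B₀} {Q' : Chain B₂ B₁} {Q'' : Chain B₃ B₂} {S : Chain A₃ A₁} {T : Chain B₃ B₁}
    (Φ : Cells f g P Q) (Ψ : Cells g h P' Q') (Θ : Cells h k P'' Q'')
    (e : P'.append P'' = S) (e' : Q'.append Q'' = T) :
    Φ.append (Cells.cat Ψ Θ e e') = Cells.cat (Φ.append Ψ) Θ
      (by rw [← e, Chain.append_assoc]) (by rw [← e', Chain.append_assoc]) := by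
  subst e e'
  exact eq_of_heq ((Cells.append_assoc_heq Φ Ψ Θ).symm.trans (Cells.cat_heq _ _ _ _).symm)

end VirtualDoubleCategory

section VirtualEquipment

variable {X : Type u} [Category.{v} X] [VirtualEquipment.{w, z} X]

/-! ### Calculus of loose-identities -/

/-- The row inserting a loose-identity at the left of a chain. -/
def insertUnit {A Y : X} (R : Chain Y A) : Cells (𝟙 A) (𝟙 Y) R (Chain.cons (unit A) R) :=
  Cells.cons (unitCell A) (Cells.ids R) rfl

theorem insertUnit_nil (A : X) :
    insertUnit (Chain.nil : Chain A A) = Cells.single (unitCell A) := by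
  rw [insertUnit, Cells.ids_nil]
  rfl

theorem ext_unit {A Y Z C₀ C₁ : X} {P : Chain A Z} {R : Chain Y A} {f : Z ⟶ C₀} {g : Y ⟶ C₁}
    {s : Loose C₁ C₀} {φ ψ : Cell f g (P.append (Chain.cons (unit A) R)) s}
    (h : comp ((Cells.ids P).append (insertUnit R)) φ
        (Category.id_comp f) (Category.id_comp g) =
      comp ((Cells.ids P).append (insertUnit R)) ψ
        (Category.id_comp f) (Category.id_comp g)) : φ = ψ :=
  (isOpcartesian_unitCell A P R f g s _).unique rfl h.symm

theorem ext_unit_left {A Y C₀ C₁ : X} {R : Chain Y A} {f : A ⟶ C₀} {g : Y ⟶ C₁}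
    {s : Loose C₁ C₀} {φ ψ : Cell f g (Chain.cons (unit A) R) s}
    (h : comp (insertUnit R) φ
        (Category.id_comp f) (Category.id_comp g) =
      comp (insertUnit R) ψ
        (Category.id_comp f) (Category.id_comp g)) : φ = ψ := by
  refine ext_unit (P := Chain.nil) ?_
  rw [Cells.ids_nil]
  exact h

theorem ext_unit_single {A C₀ C₁ : X} {f : A ⟶ C₀} {g : A ⟶ C₁}
    {s : Loose C₁ C₀} {φ ψ : Cell f g (Chain.single (unit A)) s}
    (h : comp (Cells.single (unitCell A)) φ (Category.id_comp f) (Category.id_comp g) =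
      comp (Cells.single (unitCell A)) ψ (Category.id_comp f) (Category.id_comp g)) :
    φ = ψ := by
  refine ext_unit_left ?_
  rw [insertUnit_nil]
  exact h

theorem unitCell_comp_leftUnitor {A W : X} (p : Loose W A) :
    comp (insertUnit (Chain.single p)) (leftUnitor p)
      (Category.id_comp _) (Category.id_comp _) = idCell p := by
  have h := leftUnitor_spec p
  rw [Cells.whisker, Cells.ids_nil] at h
  exact h

theorem unitCell_comp_unitMap {A B : X} (g : A ⟶ B) :
    comp (Cells.single (unitCell A)) (unitMap g) (Category.id_comp _) (Category.id_comp _) =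
      tightId g := by
  have h := unitMap_spec g
  rw [Cells.whisker, Cells.ids_nil] at h
  exact h

theorem tightId_id (A : X) : tightId (𝟙 A) = unitCell A := by
  have h := comp_ids (unitCell A) (Category.id_comp _) (Category.id_comp _)
  rw [Cells.ids_nil] at h
  exact h

theorem nil_comp_tightId {A B C : X} (f : A ⟶ B) (g : B ⟶ C) {k : A ⟶ C} (e e' : f ≫ g = k) :
    comp (Cells.nil f) (tightId g) e e' = tightId k := by
  subst e
  exact ((Cells.IsComp.nil f g rfl).comp_eq (unitCell C) _ _ _ _ _ _).symm

/-- The action of a 2-cell with codomain `B(1, 1)` on a 2-cell whose codomain is a loose-cell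
into `B`. -/
noncomputable def dot {Y Z B V W : X} {f : Z ⟶ B} {c : Y ⟶ B} {g : V ⟶ W} {P : Chain Y Z}
    {R : Chain V Y} {p : Loose W B} (γ : Cell f c P (unit B)) (χ : Cell c g R p) :
    Cell f g (P.append R) p :=
  comp (Cells.cons γ (Cells.single χ) rfl) (leftUnitor p) (Category.comp_id f)
    (Category.comp_id g)

/-- The action is a two-cell row followed by the unitor, so naturality in both arguments is
associativity of composition. -/
theorem comp_dot {Y Z B V W Y' Z' V' : X} {f : Z ⟶ B} {c : Y ⟶ B} {g : V ⟶ W} {P : Chain Y Z}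
    {R : Chain V Y} {p : Loose W B} {x : Z' ⟶ Z} {y : Y' ⟶ Y} {t : V' ⟶ V} {P' : Chain Y' Z'}
    {R' : Chain V' Y'} (Φ : Cells x y P' P) (Ω : Cells y t R' R) (γ : Cell f c P (unit B))
    (χ : Cell c g R p) {k : Z' ⟶ B} {n : Y' ⟶ B} {k' : V' ⟶ W} (e : x ≫ f = k) (e' : t ≫ g = k')
    (e'' : y ≫ c = n) :
    comp (Φ.append Ω) (dot γ χ) e e' = dot (comp Φ γ e e'') (comp Ω χ e'' e') :=
  (((Cells.IsComp.single Φ γ e e'').append (Cells.IsComp.single Ω χ e'' e')).comp_eq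
    (leftUnitor p) _ _ _ _ _ _).symm

theorem tightId_dot {B V W Z : X} {f : Z ⟶ B} {g : V ⟶ W} {R : Chain V Z} {p : Loose W B}
    (χ : Cell f g R p) : dot (tightId f) χ = χ := by
  have h : Cells.IsComp (Cells.single χ)
      (insertUnit (Chain.single p))
      (Cells.cons (tightId f) (Cells.single χ) rfl) :=
    Cells.IsComp.cons (Cells.nil f) (unitCell B) (Cells.IsComp.ids_right (Cells.single χ)) _ _
  refine (h.comp_eq (leftUnitor p) _ _ (Category.comp_id _) (Category.comp_id _)
    (Category.id_comp _) (Category.id_comp _)).trans ?_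
  rw [unitCell_comp_leftUnitor]
  exact comp_single_idCell χ _ _

/-- Every 2-cell is determined by its precomposition with the 2-cell of a loose-identity. -/
theorem eq_dot_unitMap {A Y C₀ C₁ : X} {R : Chain Y A} {f : A ⟶ C₀} {g : Y ⟶ C₁}
    {s : Loose C₁ C₀} (δ : Cell f g (Chain.cons (unit A) R) s) {ε : Cell f g R s}
    (h : comp (insertUnit R) δ
      (Category.id_comp f) (Category.id_comp g) = ε) : δ = dot (unitMap f) ε := by
  refine ext_unit_left (h.trans ?_)
  refine Eq.trans ?_ (comp_dot (Cells.single (unitCell A)) (Cells.ids R) (unitMap f) ε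
    (Category.id_comp _) (Category.id_comp _) (Category.id_comp _)).symm
  rw [unitCell_comp_unitMap, comp_ids]
  exact (tightId_dot ε).symm

/-- This is naturality of the left unitor: the unitor followed by `ψ` becomes `ψ` on inserting the
unit, hence equals the action of `unitMap a` on `ψ`. -/
theorem dot_comp {Y Z B V W B' W' : X} {f : Z ⟶ B} {c : Y ⟶ B} {g : V ⟶ W} {P : Chain Y Z}
    {R : Chain V Y} {p : Loose W B} {q : Loose W' B'} {a : B ⟶ B'} {b : W ⟶ W'}
    (γ : Cell f c P (unit B)) (χ : Cell c g R p) (ψ : Cell a b (Chain.single p) q)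
    {k : Z ⟶ B'} {n : Y ⟶ B'} {k' : V ⟶ W'} (e : f ≫ a = k) (e' : g ≫ b = k') (e'' : c ≫ a = n) :
    comp (Cells.single (dot γ χ)) ψ e e' =
      dot (comp (Cells.single γ) (unitMap a) e e'') (comp (Cells.single χ) ψ e'' e') := by
  refine (comp_single_comp _ _ ψ _ _ _ _ e e' (Category.id_comp _) (Category.id_comp _)).trans ?_
  rw [eq_dot_unitMap (comp (Cells.single (leftUnitor p)) ψ (Category.id_comp a)
    (Category.id_comp b)) (ε := ψ) ?_]
  · exact comp_dot (Cells.single γ) (Cells.single χ) (unitMap a) ψ e e' e''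
  · refine (comp_single_comp (insertUnit _) (leftUnitor p) ψ (Category.id_comp _)
      (Category.id_comp _) (Category.id_comp _) (Category.id_comp _) _ _ _ _).symm.trans ?_
    rw [unitCell_comp_leftUnitor]
    exact idCell_comp ψ _ _

theorem unitMap_id (A : X) : unitMap (𝟙 A) = idCell (unit A) := by
  refine ext_unit_single ?_
  rw [unitCell_comp_unitMap, comp_single_idCell, tightId_id]

theorem dot_comp_globular {Y Z B V W W' : X} {f : Z ⟶ B} {c : Y ⟶ B} {g : V ⟶ W} {P : Chain Y Z}
    {R : Chain V Y} {p : Loose W B} {q : Loose W' B} {b : W ⟶ W'}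
    (γ : Cell f c P (unit B)) (χ : Cell c g R p) (ψ : Cell (𝟙 B) b (Chain.single p) q)
    {k' : V ⟶ W'} (e : f ≫ 𝟙 B = f) (e' : g ≫ b = k') :
    comp (Cells.single (dot γ χ)) ψ e e' =
      dot γ (comp (Cells.single χ) ψ (Category.comp_id c) e') := by
  rw [dot_comp γ χ ψ e e' (Category.comp_id c), unitMap_id, comp_single_idCell]

/-- The right unit law. By naturality it reduces to the case where `γ` is the identity on `B(1, 1)`,
which may be tested after inserting a unit on the left, where the left unit law applies. -/
theorem dot_tightId_heq {Y Z B : X} {f : Z ⟶ B} {c : Y ⟶ B} {P : Chain Y Z}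
    (γ : Cell f c P (unit B)) : HEq (dot γ (tightId c)) γ := by
  have h : dot (idCell (unit B)) (unitCell B) = idCell (unit B) := by
    refine ext_unit_single ?_
    refine (comp_dot (Cells.single (unitCell B)) (Cells.nil (𝟙 B)) (idCell (unit B)) (unitCell B)
      (Category.id_comp _) (Category.id_comp _) (Category.id_comp _)).trans ?_
    rw [comp_single_idCell, ← tightId_id]
    exact (tightId_dot _).trans (nil_comp_tightId _ _ _ _)
  have h' := comp_dot (Cells.single γ) (Cells.nil c) (idCell (unit B)) (unitCell B)
      (Category.comp_id _) (Category.comp_id _) (Category.comp_id _)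
  rw [comp_single_idCell, h] at h'
  refine (heq_of_eq h'.symm).trans ?_
  refine (comp_heq _ _ P.append_nil rfl (Cells.append_nil_heq _) HEq.rfl).trans ?_
  exact heq_of_eq (comp_single_idCell γ _ _)

end VirtualEquipment

/-! ### Cartesian and invertible 2-cells -/

section VirtualDoubleCategory

variable {X : Type u} [Category.{v} X] [VirtualDoubleCategory.{w, z} X]

namespace IsCartesian

variable {A₀ A₁ B₀ B₁ : X} {f : A₀ ⟶ B₀} {g : A₁ ⟶ B₁} {p : Loose A₁ A₀} {q : Loose B₁ B₀}
  {κ : Cell f g (Chain.single p) q}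

theorem bijective (hκ : IsCartesian κ) {Z₀ Z₁ : X} (f' : Z₀ ⟶ A₀) (g' : Z₁ ⟶ A₁)
    (R : Chain Z₁ Z₀) {k : Z₀ ⟶ B₀} {k' : Z₁ ⟶ B₁} (e : f' ≫ f = k) (e' : g' ≫ g = k') :
    Function.Bijective fun ψ : Cell f' g' R p => comp (Cells.single ψ) κ e e' := by
  subst e e'
  exact Function.bijective_iff_existsUnique _ |>.2 fun φ => hκ f' g' R φ

theorem ext (hκ : IsCartesian κ) {Z₀ Z₁ : X} {f' : Z₀ ⟶ A₀} {g' : Z₁ ⟶ A₁}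
    {R : Chain Z₁ Z₀} {k : Z₀ ⟶ B₀} {k' : Z₁ ⟶ B₁} {φ ψ : Cell f' g' R p} (e : f' ≫ f = k)
    (e' : g' ≫ g = k') (h : comp (Cells.single φ) κ e e' = comp (Cells.single ψ) κ e e') :
    φ = ψ :=
  (hκ.bijective f' g' R e e').1 h

theorem exists_comp_eq (hκ : IsCartesian κ) {Z₀ Z₁ : X} {f' : Z₀ ⟶ A₀} {g' : Z₁ ⟶ A₁}
    {R : Chain Z₁ Z₀} {k : Z₀ ⟶ B₀} {k' : Z₁ ⟶ B₁} (φ : Cell k k' R q) (e : f' ≫ f = k)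
    (e' : g' ≫ g = k') : ∃ ψ : Cell f' g' R p, comp (Cells.single ψ) κ e e' = φ :=
  (hκ.bijective f' g' R e e').2 φ

variable {C₀ C₁ : X} {f₁ : B₀ ⟶ C₀} {g₁ : B₁ ⟶ C₁} {r : Loose C₁ C₀}
  {κ' : Cell f₁ g₁ (Chain.single q) r} {f₂ : A₀ ⟶ C₀} {g₂ : A₁ ⟶ C₁}

/-- Pasting with the composite is pasting with `κ` followed by pasting with `κ'`; as the latter is
bijective, the other two are bijective together. -/
theorem comp_iff (hκ' : IsCartesian κ') (e : f ≫ f₁ = f₂) (e' : g ≫ g₁ = g₂) :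
    IsCartesian (comp (Cells.single κ) κ' e e') ↔ IsCartesian κ := by
  subst e e'
  have key : ∀ {Z₀ Z₁ : X} (f' : Z₀ ⟶ A₀) (g' : Z₁ ⟶ A₁) (R : Chain Z₁ Z₀),
      (fun ψ : Cell f' g' R p => comp (Cells.single ψ) (comp (Cells.single κ) κ' rfl rfl)
        rfl rfl) = (fun ψ : Cell (f' ≫ f) (g' ≫ g) R q => comp (Cells.single ψ) κ'
          (Category.assoc _ _ _) (Category.assoc _ _ _)) ∘
        fun ψ => comp (Cells.single ψ) κ rfl rfl := by
    intro Z₀ Z₁ f' g' R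
    funext ψ
    exact (comp_single_comp _ _ _ _ _ _ _ _ _ _ _).symm
  constructor
  · intro h Z₀ Z₁ f' g' R
    have h' := h.bijective f' g' R rfl rfl
    rw [key, Function.Bijective.of_comp_iff' (hκ'.bijective _ _ _ _ _)] at h'
    exact (Function.bijective_iff_existsUnique _).1 h'
  · intro h Z₀ Z₁ f' g' R
    have h' := (hκ'.bijective (f' ≫ f) (g' ≫ g) R (Category.assoc _ _ _)
      (Category.assoc _ _ _)).comp (h.bijective f' g' R rfl rfl)
    rw [← key] at h'
    exact (Function.bijective_iff_existsUnique _).1 h'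

end IsCartesian

variable {A B : X} {p q : Loose B A}

theorem IsInvertible.isCartesian {φ : Cell (𝟙 A) (𝟙 B) (Chain.single p) q}
    (h : IsInvertible φ) : IsCartesian φ := by
  obtain ⟨ψ, h₁, h₂⟩ := h
  intro Z₀ Z₁ f' g' R χ
  refine ⟨comp (Cells.single χ) ψ (by simp) (by simp), ?_, ?_⟩
  · refine (comp_single_comp _ _ _ _ _ _ _ (Category.comp_id _) (Category.comp_id _)
      (Category.comp_id _) (Category.comp_id _)).trans ?_
    rw [vcomp] at h₂
    rw [h₂]
    exact comp_single_idCell _ _ _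
  · rintro ω rfl
    refine Eq.symm ((comp_single_comp _ _ _ _ _ _ _ (Category.comp_id _) (Category.comp_id _)
      (Category.comp_id _) (Category.comp_id _)).trans ?_)
    rw [vcomp] at h₁
    rw [h₁]
    exact comp_single_idCell _ _ _

/-! ### Isomorphisms of loose-cells and uniqueness of right lifts -/

theorem LooseIso.symm (h : LooseIso p q) : LooseIso q p := by
  obtain ⟨φ, ψ, h₁, h₂⟩ := h
  exact ⟨ψ, φ, h₂, h₁⟩

/-- Cartesian 2-cells with the same codomain have isomorphic domains. -/
theorem IsCartesian.looseIso {C D : X} {f : A ⟶ C} {g : B ⟶ D} {r : Loose D C}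
    {κ : Cell f g (Chain.single p) r} {κ' : Cell f g (Chain.single q) r}
    (hκ : IsCartesian κ) (hκ' : IsCartesian κ') : LooseIso p q := by
  obtain ⟨φ, hφ⟩ := hκ'.exists_comp_eq κ (Category.id_comp f) (Category.id_comp g)
  obtain ⟨ψ, hψ⟩ := hκ.exists_comp_eq κ' (Category.id_comp f) (Category.id_comp g)
  refine ⟨φ, ψ, ?_, ?_⟩
  · refine hκ.ext (Category.id_comp f) (Category.id_comp g) ?_
    refine (comp_single_comp _ _ _ _ _ _ _ (Category.id_comp f) (Category.id_comp g)
      (Category.id_comp f) (Category.id_comp g)).trans ?_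
    rw [hψ, hφ, idCell_comp]
  · refine hκ'.ext (Category.id_comp f) (Category.id_comp g) ?_
    refine (comp_single_comp _ _ _ _ _ _ _ (Category.id_comp f) (Category.id_comp g)
      (Category.id_comp f) (Category.id_comp g)).trans ?_
    rw [hφ, hψ, idCell_comp]

theorem LooseIso.trans {r : Loose B A} (h : LooseIso p q) (h' : LooseIso q r) : LooseIso p r := by
  obtain ⟨φ, hφ⟩ := h
  obtain ⟨θ, hθ⟩ := h'
  have hid : IsCartesian (idCell r) :=
    IsInvertible.isCartesian ⟨idCell r, idCell_comp _ _ _, idCell_comp _ _ _⟩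
  exact ((hθ.isCartesian.comp_iff (Category.id_comp _) (Category.id_comp _)).2
    hφ.isCartesian).looseIso hid

/-- Right lifts of isomorphic loose-cells are isomorphic. -/
theorem IsRightLift.looseIso {W Y Z : X} {P : Chain Y Z} {q q' : Loose W Z} {l l' : Loose W Y}
    {ϖ : Cell (𝟙 Z) (𝟙 W) (P.append (Chain.single l)) q}
    {ϖ' : Cell (𝟙 Z) (𝟙 W) (P.append (Chain.single l')) q'}
    (h : IsRightLift P ϖ) (h' : IsRightLift P ϖ') (e : LooseIso q q') : LooseIso l l' := by
  obtain ⟨θ, θ', h₁, h₂⟩ := e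
  rw [vcomp] at h₁ h₂
  -- Stated for arbitrary lifts so that it yields both composites by exchanging roles: `vcomp φ ψ`
  -- and the identity both factor `σ` through itself, hence agree.
  have key : ∀ {s s' : Loose W Z} {m m' : Loose W Y}
      {σ : Cell (𝟙 Z) (𝟙 W) (P.append (Chain.single m)) s}
      {σ' : Cell (𝟙 Z) (𝟙 W) (P.append (Chain.single m')) s'}
      {τ : Cell (𝟙 Z) (𝟙 W) (Chain.single s) s'} {τ' : Cell (𝟙 Z) (𝟙 W) (Chain.single s') s}
      {φ : Cell (𝟙 Y) (𝟙 W) (Chain.single m) m'} {ψ : Cell (𝟙 Y) (𝟙 W) (Chain.single m') m},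
      IsRightLift P σ →
      comp (Cells.single τ) τ' (Category.id_comp _) (Category.id_comp _) = idCell s →
      comp ((Cells.ids P).append (Cells.single φ)) σ' (Category.id_comp _) (Category.id_comp _) =
        comp (Cells.single σ) τ (Category.id_comp _) (Category.id_comp _) →
      comp ((Cells.ids P).append (Cells.single ψ)) σ (Category.id_comp _) (Category.id_comp _) =
        comp (Cells.single σ') τ' (Category.id_comp _) (Category.id_comp _) →
      vcomp φ ψ = idCell m := by
    intro s s' m m' σ σ' τ τ' φ ψ hσ hτ hφ hψ
    have h₁ : comp ((Cells.ids P).append (Cells.single (vcomp φ ψ))) σ (Category.id_comp _)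
        (Category.id_comp _) = σ := by
      refine (((Cells.IsComp.ids_left (Cells.ids P)).append
        (Cells.IsComp.single (Cells.single φ) ψ _ _)).comp_eq σ _ _ (Category.id_comp _)
          (Category.id_comp _) (Category.id_comp _) (Category.id_comp _)).trans ?_
      rw [hψ]
      refine (comp_single_comp _ σ' τ' (Category.id_comp _) (Category.id_comp _) (Category.id_comp _)
        (Category.id_comp _) _ _ _ _).symm.trans ?_
      rw [hφ]
      refine (comp_single_comp _ _ _ _ _ _ _ (Category.id_comp _) (Category.id_comp _)
        (Category.id_comp _) (Category.id_comp _)).trans ?_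
      rw [hτ, comp_single_idCell]
    refine (hσ _ σ).unique h₁ ?_
    refine Eq.trans ?_ (comp_ids σ (Category.id_comp _) (Category.id_comp _))
    rw [Cells.ids_append, Cells.ids_single]
  obtain ⟨φ, hφ, -⟩ := h' _ (comp (Cells.single ϖ) θ (Category.id_comp _) (Category.id_comp _))
  obtain ⟨ψ, hψ, -⟩ := h _ (comp (Cells.single ϖ') θ' (Category.id_comp _) (Category.id_comp _))
  exact ⟨φ, ψ, key h h₁ hφ hψ, key h' h₂ hψ hφ⟩

end VirtualDoubleCategory

section VirtualEquipment

variable {X : Type u} [Category.{v} X] [VirtualEquipment.{w, z} X]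

/-! ### Bending along conjoints -/

theorem conjointUnit_comp_cart {Y Z : X} (j : Z ⟶ Y) :
    comp (Cells.single (conjointUnit j)) (cart (unit Y) j (𝟙 Y)) (Category.id_comp j)
      (Category.comp_id j) = tightId j :=
  factor_comp_cart _ _ _ _ _ _ _ _

theorem exists_rightUnitor {A W : X} (p : Loose W A) :
    ∃ ρ : Cell (𝟙 A) (𝟙 W) (Chain.cons p (Chain.single (unit W))) p,
      comp ((Cells.ids (Chain.single p)).append (Cells.single (unitCell W))) ρ
        (Category.id_comp _) (Category.id_comp _) = idCell p := by
  obtain ⟨ρ, h, -⟩ := isOpcartesian_unitCell W (Chain.single p) Chain.nil (𝟙 A) (𝟙 W) p (idCell p)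
  refine ⟨ρ, ?_⟩
  rw [Cells.whisker, Cells.ids_nil] at h
  exact h

/-- The right unitor `p, X(1, 1) ⇒ p`. -/
noncomputable def rightUnitor {A W : X} (p : Loose W A) :
    Cell (𝟙 A) (𝟙 W) (Chain.cons p (Chain.single (unit W))) p :=
  (exists_rightUnitor p).choose

theorem unitCell_comp_rightUnitor {A W : X} (p : Loose W A) :
    comp ((Cells.ids (Chain.single p)).append (Cells.single (unitCell W))) (rightUnitor p)
      (Category.id_comp _) (Category.id_comp _) = idCell p :=
  (exists_rightUnitor p).choose_spec

theorem ext_unit_right {A Z C₀ C₁ : X} {P : Chain A Z} {f : Z ⟶ C₀} {g : A ⟶ C₁}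
    {s : Loose C₁ C₀} {φ ψ : Cell f g (P.append (Chain.single (unit A))) s}
    (h : comp ((Cells.ids P).append (Cells.single (unitCell A))) φ
        (Category.id_comp f) (Category.id_comp g) =
      comp ((Cells.ids P).append (Cells.single (unitCell A))) ψ
        (Category.id_comp f) (Category.id_comp g)) : φ = ψ := by
  refine ext_unit (P := P) (R := Chain.nil) ?_
  rw [insertUnit_nil]
  exact h

theorem ids_append_unitCell_comp_dot {Z B : X} {f : Z ⟶ B} {S : Chain B Z}
    (δ : Cell f (𝟙 B) S (unit B)) :
    comp ((Cells.ids S).append (Cells.single (unitCell B))) (dot δ (idCell (unit B)))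
      (Category.id_comp _) (Category.id_comp _) = dot δ (tightId (𝟙 B)) := by
  refine (comp_dot (Cells.ids S) (Cells.single (unitCell B)) δ (idCell (unit B))
    (Category.id_comp _) (Category.id_comp _) (Category.id_comp _)).trans ?_
  rw [comp_ids, comp_single_idCell, tightId_id]

/-- The second triangle identity for a conjoint. -/
theorem conjointUnit_cart_comp_rightUnitor {Y Z : X} (j : Z ⟶ Y) :
    comp (Cells.cons (conjointUnit j) (Cells.single (cart (unit Y) j (𝟙 Y))) rfl)
      (rightUnitor (conjoint j)) (Category.id_comp _) (Category.id_comp _) =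
        idCell (conjoint j) := by
  refine (isCartesian_cart (unit Y) j (𝟙 Y)).ext (Category.id_comp j) (Category.id_comp (𝟙 Y)) ?_
  refine (comp_single_comp _ _ _ _ _ _ _ (Category.id_comp _) (Category.id_comp _)
    (Category.id_comp _) (Category.id_comp _)).trans ?_
  -- Both sides become the cartesian 2-cell when a unit is inserted on the right.
  have h : comp (Cells.single (rightUnitor (conjoint j))) (cart (unit Y) j (𝟙 Y))
      (Category.id_comp j) (Category.id_comp (𝟙 Y)) =
        dot (cart (unit Y) j (𝟙 Y)) (idCell (unit Y)) := by
    refine ext_unit_right (P := Chain.single (conjoint j)) ?_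
    refine Eq.trans ?_ (ids_append_unitCell_comp_dot _).symm
    refine (comp_single_comp _ _ _ (Category.id_comp _) (Category.id_comp _) (Category.id_comp _)
      (Category.id_comp _) _ _ _ _).symm.trans ?_
    rw [unitCell_comp_rightUnitor]
    exact (idCell_comp _ _ _).trans (eq_of_heq (dot_tightId_heq _)).symm
  rw [h]
  refine Eq.trans ?_ (idCell_comp _ _ _).symm
  refine (comp_dot (Cells.single (conjointUnit j)) (Cells.single (cart (unit Y) j (𝟙 Y)))
    (cart (unit Y) j (𝟙 Y)) (idCell (unit Y)) (Category.id_comp _) (Category.id_comp _)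
    (Category.comp_id _)).trans ?_
  rw [conjointUnit_comp_cart, comp_single_idCell]
  exact tightId_dot _

theorem ids_append_conjointUnit_comp_dot {Z B V : X} {f : Z ⟶ B} {g : V ⟶ B} {R : Chain V Z}
    (χ : Cell f g R (unit B)) :
    comp ((Cells.ids R).append (Cells.single (conjointUnit g)))
      (dot χ (cart (unit B) g (𝟙 B))) (Category.id_comp _) (Category.comp_id _) =
        dot χ (tightId g) := by
  refine (comp_dot (Cells.ids R) (Cells.single (conjointUnit g)) χ (cart (unit B) g (𝟙 B))
    (Category.id_comp _) (Category.comp_id _) (Category.id_comp _)).trans ?_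
  rw [comp_ids, conjointUnit_comp_cart]

theorem dot_cart_heq {Z B V : X} {f : Z ⟶ B} {g : V ⟶ B} {R : Chain V Z}
    (δ : Cell f (𝟙 B) (R.append (Chain.single (conjoint g))) (unit B)) :
    HEq (dot (comp ((Cells.ids R).append (Cells.single (conjointUnit g))) δ
      (Category.id_comp _) (Category.comp_id _)) (cart (unit B) g (𝟙 B))) δ := by
  -- These three equations rebracket concatenations; `key` below says that an identity row remains
  -- neutral when its domain is renamed in this way.
  have e₁ : R.append (Chain.cons (conjoint g) (Chain.single (unit B))) =
      (R.append (Chain.single (conjoint g))).append (Chain.single (unit B)) :=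
    (Chain.append_assoc R (Chain.single (conjoint g)) (Chain.single (unit B))).symm
  have e₂ : R.append (Chain.single (conjoint g)) =
      (R.append Chain.nil).append (Chain.single (conjoint g)) :=
    (Chain.append_assoc R Chain.nil (Chain.single (conjoint g))).symm
  have e₃ : R.append (Chain.single (conjoint g)) =
      (R.append (Chain.single (conjoint g))).append Chain.nil :=
    (Chain.append_nil _).symm
  have key : ∀ {S : Chain B Z} (e : R.append (Chain.single (conjoint g)) = S),
      HEq (comp (Cells.cat (Cells.ids R) (Cells.single (idCell (conjoint g))) e rfl) δ
        (Category.id_comp _) (Category.id_comp _)) δ := by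
    rintro S rfl
    refine heq_of_eq (Eq.trans ?_ (comp_ids δ (Category.id_comp _) (Category.id_comp _)))
    rw [Cells.ids_append, Cells.ids_single]
    rfl
  -- A unit on the right of `δ` may equally be absorbed into the conjoint by its right unitor. This
  -- turns the claim into the second triangle identity.
  have h : dot δ (idCell (unit B)) = comp (Cells.cat (Cells.ids R)
      (Cells.single (rightUnitor (conjoint g))) e₁ rfl) δ
      (Category.id_comp _) (Category.id_comp _) := by
    refine ext_unit_right ?_
    rw [ids_append_unitCell_comp_dot]
    refine eq_of_heq ((dot_tightId_heq δ).trans ((key e₃).symm.trans (heq_of_eq ?_)))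
    have H := (Cells.IsComp.ids_left (Cells.ids R)).cat (Cells.IsComp.single
      ((Cells.ids (Chain.single (conjoint g))).append (Cells.single (unitCell B)))
      (rightUnitor (conjoint g)) (Category.id_comp _) (Category.id_comp _)) e₃ e₁ rfl
    rw [unitCell_comp_rightUnitor] at H
    refine (H.comp_eq δ (Category.id_comp _) (Category.id_comp _) (Category.id_comp _)
      (Category.id_comp _) (Category.id_comp _) (Category.id_comp _)).trans ?_
    congr 1
    rw [Cells.ids_append, Cells.append_append_eq_cat]
  refine HEq.trans (heq_of_eq ?_) (key e₂)
  have h₁ := comp_dot ((Cells.ids R).append (Cells.single (conjointUnit g)))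
    (Cells.single (cart (unit B) g (𝟙 B))) δ (idCell (unit B)) (Category.id_comp _)
    (Category.id_comp _) (Category.comp_id _)
  rw [comp_single_idCell] at h₁
  refine h₁.symm.trans ?_
  rw [h]
  have H := (Cells.IsComp.ids_left (Cells.ids R)).cat (Cells.IsComp.single
      (Cells.cons (conjointUnit g) (Cells.single (cart (unit B) g (𝟙 B))) rfl)
      (rightUnitor (conjoint g)) (Category.id_comp _) (Category.id_comp _)) e₂ e₁ rfl
  rw [conjointUnit_cart_comp_rightUnitor] at H
  refine Eq.trans ?_ (H.comp_eq δ (Category.id_comp _) (Category.id_comp _) (Category.id_comp _)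
      (Category.id_comp _) (Category.id_comp _) (Category.id_comp _)).symm
  congr 1
  rw [Cells.append_append_eq_cat]
  rfl

/-- A tight-cell on the right of the frame can be bent into a conjoint at the end of the chain. The
inverse acts on the cartesian 2-cell of the conjoint. -/
theorem bijective_comp_conjointUnit {Z B V : X} (f : Z ⟶ B) (g : V ⟶ B) {R T : Chain V Z}
    {S : Chain B Z} (e : R.append Chain.nil = T) (e' : R.append (Chain.single (conjoint g)) = S) :
    Function.Bijective fun δ : Cell f (𝟙 B) S (unit B) =>
      comp (Cells.cat (Cells.ids R) (Cells.single (conjointUnit g)) e e') δ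
        (Category.id_comp f) (Category.comp_id g) := by
  subst e e'
  constructor
  · intro δ δ' h
    refine eq_of_heq ((dot_cart_heq δ).symm.trans (HEq.trans (heq_of_eq ?_) (dot_cart_heq δ')))
    exact congrArg (dot · _) h
  · have key : ∀ {R' : Chain V Z} (hR : R' = R) (χ : Cell f g R' (unit B)),
        ∃ δ : Cell f (𝟙 B) (R.append (Chain.single (conjoint g))) (unit B), HEq (comp ((Cells.ids R).append (Cells.single (conjointUnit g))) δ
          (Category.id_comp f) (Category.comp_id g)) χ := by
      rintro _ rfl χ
      refine ⟨dot χ (cart (unit B) g (𝟙 B)), ?_⟩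
      rw [ids_append_conjointUnit_comp_dot]
      exact dot_tightId_heq χ
    intro χ
    obtain ⟨δ, h⟩ := key R.append_nil χ
    exact ⟨δ, eq_of_heq h⟩

/-- The definition of a colimit tests only 2-cells with identity right-hand side; bending `g` into
the chain reduces the general case to that one. -/
theorem bijective_dot {Y Z B V : X} {P : Chain Y Z} {f : Z ⟶ B} {c : Y ⟶ B}
    {γ : Cell f c P (unit B)}
    (h : ∀ R : Chain B Y, Function.Bijective fun χ : Cell c (𝟙 B) R (unit B) => dot γ χ)
    (g : V ⟶ B) (R : Chain V Y) :
    Function.Bijective fun χ : Cell c g R (unit B) => dot γ χ := by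
  have h₁ := bijective_comp_conjointUnit c g R.append_nil rfl
  rw [← Function.Bijective.of_comp_iff _ h₁]
  have h₂ := (bijective_comp_conjointUnit f g (R := P.append R) (Chain.append_nil _)
    (Chain.append_assoc P R _)).comp (h (R.append (Chain.single (conjoint g))))
  convert h₂ using 1
  funext δ
  have h₃ := comp_dot (Cells.ids P) (Cells.cat (Cells.ids R) (Cells.single (conjointUnit g))
    R.append_nil rfl) γ δ (Category.id_comp _) (Category.comp_id _) (Category.id_comp _)
  rw [comp_ids] at h₃
  refine h₃.symm.trans ?_
  rw [Cells.append_cat]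
  simp only [Function.comp, Cells.ids_append]

/-- Pasting a conjoint with its unit does not change a 2-cell. -/
theorem conjointUnit_cons_dot_comp {A E V W : X} {j : A ⟶ E} {l : Loose W E} {q : Loose W A}
    {g : V ⟶ W} {R : Chain V E} (ω : Cell (𝟙 E) g R l)
    (δ : Cell (𝟙 A) (𝟙 W) (Chain.cons (conjoint j) (Chain.single l)) q) :
    comp (Cells.cons (conjointUnit j) (Cells.single (dot (cart (unit E) j (𝟙 E)) ω)) rfl) δ
        (Category.id_comp _) (Category.comp_id _) =
      comp (Cells.cons (idCell (conjoint j)) (Cells.single ω) rfl) δ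
        (Category.id_comp _) (Category.comp_id _) := by
  -- A unit between the conjoint and `l` may be absorbed on either side: both composites are `δ`
  -- once the unit is inserted.
  have h : comp (Cells.cons (idCell (conjoint j)) (Cells.single (leftUnitor l)) rfl) δ
        (Category.id_comp _) (Category.id_comp _) =
      comp (Cells.cons (rightUnitor (conjoint j)) (Cells.single (idCell l)) rfl) δ
        (Category.id_comp _) (Category.id_comp _) := by
    refine ext_unit (P := Chain.single (conjoint j)) (R := Chain.single l) ?_
    have H₁ := (Cells.IsComp.ids_left (Cells.single (idCell (conjoint j)))).append
      (Cells.IsComp.single (insertUnit (Chain.single l)) (leftUnitor l) (Category.id_comp _)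
        (Category.id_comp _))
    have H₂ := (Cells.IsComp.single ((Cells.ids (Chain.single (conjoint j))).append
      (Cells.single (unitCell E))) (rightUnitor (conjoint j)) (Category.id_comp _)
        (Category.id_comp _)).append (Cells.IsComp.ids_right (Cells.single (idCell l)))
    rw [unitCell_comp_leftUnitor] at H₁
    rw [unitCell_comp_rightUnitor] at H₂
    refine (H₁.comp_eq δ (Category.id_comp _) (Category.id_comp _) _ _ _ _).symm.trans
      ((H₂.comp_eq δ (Category.id_comp _) (Category.id_comp _) (Category.id_comp _)
        (Category.id_comp _) (Category.id_comp _) (Category.id_comp _)).trans ?_)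
    simp only [insertUnit, Cells.ids_single]
    rfl
  have H₁ := (Cells.IsComp.ids_right (Cells.single (conjointUnit j))).append
    (Cells.IsComp.single (Cells.cons (cart (unit E) j (𝟙 E)) (Cells.single ω) rfl) (leftUnitor l)
      (Category.comp_id _) (Category.comp_id _))
  have H₂ := (Cells.IsComp.single (Cells.cons (conjointUnit j)
    (Cells.single (cart (unit E) j (𝟙 E))) rfl) (rightUnitor (conjoint j)) (Category.id_comp _)
      (Category.id_comp _)).append (Cells.IsComp.ids_right (Cells.single ω))
  rw [conjointUnit_cart_comp_rightUnitor] at H₂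
  refine (H₁.comp_eq δ (Category.id_comp _) (Category.comp_id _) (Category.id_comp _)
    (Category.comp_id _) (Category.id_comp _) (Category.id_comp _)).trans ?_
  refine Eq.trans ?_ (H₂.comp_eq δ (Category.id_comp _) (Category.comp_id _) (Category.id_comp _)
    (Category.comp_id _) (Category.id_comp _) (Category.id_comp _)).symm
  simp only [Cells.ids_single]
  exact congrArg (fun δ' => comp _ δ' _ _) h

end VirtualEquipment

section VirtualEquipment

variable {X : Type u} [Category.{v} X] [VirtualEquipment.{w, z} X]

/-! ### Colimits in terms of the action on 2-cells -/

/-- The 2-cell into the loose-identity that corresponds to a cocone. -/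
def coconeCell {Y Z B : X} {P : Chain Y Z} {f : Z ⟶ B} {c : Y ⟶ B} (γ : Cocone P f c) :
    Cell f c P (unit B) :=
  comp (Cells.single γ) (cart (unit B) f c) (Category.id_comp f) (Category.id_comp c)

theorem exists_coconeCell_eq {Y Z B : X} {P : Chain Y Z} {f : Z ⟶ B} {c : Y ⟶ B}
    (γ : Cell f c P (unit B)) : ∃ γ' : Cocone P f c, coconeCell γ' = γ :=
  (isCartesian_cart (unit B) f c).exists_comp_eq γ _ _

theorem coconeCell_map {Y Z B B' : X} {P : Chain Y Z} {f : Z ⟶ B} {c : Y ⟶ B}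
    (γ : Cocone P f c) (g : B ⟶ B') :
    coconeCell (γ.map g) = comp (Cells.single (coconeCell γ)) (unitMap g) rfl rfl :=
  factor_comp_cart _ _ _ _ _ _ _ _

/-- The cartesian 2-cells of `p(c, 1)` and `p(f, 1)` translate cells into these restrictions to
cells into `p`, under which factorisation through `act γ p` becomes the action of the cocone. -/
theorem respects_iff {Y Z B W : X} {P : Chain Y Z} {f : Z ⟶ B} {c : Y ⟶ B} (p : Loose W B)
    (γ : Cocone P f c) : Respects p γ ↔ ∀ R : Chain W Y,
      Function.Bijective fun χ : Cell c (𝟙 W) R p => dot (coconeCell γ) χ := by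
  refine forall_congr' fun R => ?_
  rw [← Function.bijective_iff_existsUnique, ← Function.Bijective.of_comp_iff'
      ((isCartesian_cart p f (𝟙 W)).bijective (𝟙 Z) (𝟙 W) (P.append R) (Category.id_comp _)
        (Category.id_comp _)),
    ← Function.Bijective.of_comp_iff _
      ((isCartesian_cart p c (𝟙 W)).bijective (𝟙 Y) (𝟙 W) R (Category.id_comp _)
        (Category.id_comp _))]
  refine Eq.to_iff (congrArg _ (funext fun ψ => ?_))
  have h : comp (Cells.single (act γ p)) (cart p f (𝟙 W)) (Category.id_comp _)
      (Category.id_comp _) = dot (coconeCell γ) (cart p c (𝟙 W)) :=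
    factor_comp_cart _ _ _ _ _ _ _ _
  refine (comp_single_comp _ (act γ p) (cart p f (𝟙 W)) _ _ _ _ (Category.id_comp _)
    (Category.id_comp _) (Category.id_comp _) (Category.id_comp _)).trans ?_
  rw [h]
  refine (comp_dot _ _ _ _ _ _ (Category.id_comp _)).trans ?_
  rw [comp_ids]
  rfl

theorem isColimit_iff {Y Z B : X} {P : Chain Y Z} {f : Z ⟶ B} {c : Y ⟶ B} (γ : Cocone P f c) :
    IsColimit γ ↔ ∀ R : Chain B Y,
      Function.Bijective fun χ : Cell c (𝟙 B) R (unit B) => dot (coconeCell γ) χ :=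
  respects_iff (unit B) γ

/-- Bending the conjoint of `c` back into the frame turns `δ` into a cocone whose action on the
cartesian 2-cell is `δ`. -/
theorem hasColimit_of_bijective {Y Z B : X} {P : Chain Y Z} {f : Z ⟶ B} {c : Y ⟶ B}
    (δ : Cell f (𝟙 B) (P.append (Chain.single (conjoint c))) (unit B))
    (h : ∀ R : Chain B Y, Function.Bijective fun ψ : Cell (𝟙 Y) (𝟙 B) R (conjoint c) =>
      comp ((Cells.ids P).append (Cells.single ψ)) δ (Category.id_comp _) (Category.id_comp _)) :
    HasColimit P f := by
  have key : ∀ {S : Chain Y Z} (_ : S = P) (χ : Cell f c S (unit B)),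
      HEq (dot χ (cart (unit B) c (𝟙 B))) δ →
        ∃ γ : Cell f c P (unit B), dot γ (cart (unit B) c (𝟙 B)) = δ := by
    rintro _ rfl χ h
    exact ⟨χ, eq_of_heq h⟩
  obtain ⟨γ₀, hγ₀⟩ := key P.append_nil _ (dot_cart_heq δ)
  obtain ⟨γ, rfl⟩ := exists_coconeCell_eq γ₀
  refine ⟨c, γ, (isColimit_iff γ).2 fun R => ?_⟩
  rw [← Function.Bijective.of_comp_iff _
    ((isCartesian_cart (unit B) c (𝟙 B)).bijective (𝟙 Y) (𝟙 B) R (Category.id_comp _)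
      (Category.id_comp _))]
  convert h R using 1
  funext ψ
  refine Eq.trans ?_ (congrArg (fun δ' => comp _ δ' (Category.id_comp _) (Category.id_comp _)) hγ₀)
  refine Eq.trans ?_ (comp_dot _ _ _ _ _ _ (Category.id_comp _)).symm
  rw [comp_ids]
  rfl

theorem IsColimit.bijective_dot {Y Z B : X} {P : Chain Y Z} {f : Z ⟶ B} {c : Y ⟶ B}
    {γ : Cocone P f c} (h : IsColimit γ) {V : X} (g : V ⟶ B) (R : Chain V Y) :
    Function.Bijective fun χ : Cell c g R (unit B) => dot (coconeCell γ) χ :=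
  VDC.bijective_dot ((isColimit_iff γ).1 h) g R

/-- Companions respect all colimits. -/
theorem IsColimit.respects_companion {Y Z B W : X} {P : Chain Y Z} {f : Z ⟶ B} {c : Y ⟶ B}
    {γ : Cocone P f c} (h : IsColimit γ) (j : W ⟶ B) : Respects (companion j) γ := by
  refine (respects_iff _ _).2 fun R => ?_
  rw [← Function.Bijective.of_comp_iff'
      ((isCartesian_cart (unit B) (𝟙 B) j).bijective f (𝟙 W) (P.append R) (Category.comp_id _)
        (Category.id_comp _))]
  -- A 2-cell into `B(1, j)` is a 2-cell into `B(1, 1)` with `j` on the right of its frame, where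
  -- the extended universal property of the colimit applies.
  have h' := (h.bijective_dot j R).comp ((isCartesian_cart (unit B) (𝟙 B) j).bijective c (𝟙 W) R
    (Category.comp_id _) (Category.id_comp _))
  convert h' using 1
  funext χ
  exact dot_comp_globular _ _ _ _ _

theorem isExact_companion (Φ : WeightClass X) {W B : X} (j : W ⟶ B) : IsExact Φ (companion j) :=
  fun _ _ _ _ _ _ _ h => h.respects_companion j

/-! ### Reflective objects -/

theorem isReflectiveIn_refl (A : X) : IsReflectiveIn A A := by
  have h : IsCartesian (idCell (unit A)) :=
    IsInvertible.isCartesian ⟨idCell (unit A), idCell_comp _ _ _, idCell_comp _ _ _⟩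
  exact ⟨𝟙 A, 𝟙 A, h.looseIso (isCartesian_cart (unit A) (𝟙 A) (𝟙 A)),
    (isCartesian_cart (unit A) (𝟙 A) (𝟙 A)).looseIso (isCartesian_cart (unit A) (𝟙 A) (𝟙 A))⟩

/-- A reflective object admits every colimit that is admitted by the ambient object. -/
theorem HasColimit.of_reflective {A B Y Z : X} {r : A ⟶ B} {l : B ⟶ A}
    (hr : IsFullyFaithful r) (hl : IsLeftAdjoint l r) {P : Chain Y Z} {f : Z ⟶ A}
    (h : HasColimit P (f ≫ r)) : HasColimit P f := by
  obtain ⟨c, γ, hγ⟩ := h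
  obtain ⟨η, hη⟩ := hr
  obtain ⟨θ, hθ⟩ := hl
  -- The 2-cell `ζ` presents `A(c ≫ l, 1)` as the restriction of `A(l, 1)` along `c`. Pasting with
  -- `A(l, 1) ≅ B(1, r)` gives the cartesian `κ`, so that `A(c ≫ l, 1)` plays the role of `B(c, r)`;
  -- likewise `η'` lets `A(1, 1)` play that of `B(r, r)`.
  obtain ⟨ζ, hζ⟩ := (isCartesian_cart (unit A) l (𝟙 A)).exists_comp_eq
    (cart (unit A) (c ≫ l) (𝟙 A)) (f' := c) (g' := 𝟙 A) rfl (Category.id_comp _)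
  have hζ' : IsCartesian ζ := by
    rw [← (isCartesian_cart (unit A) l (𝟙 A)).comp_iff rfl (Category.id_comp _), hζ]
    exact isCartesian_cart _ _ _
  have hη' := ((isCartesian_cart (unit B) r r).comp_iff (Category.id_comp r)
    (Category.id_comp r)).2 hη.isCartesian
  have hκ := ((isCartesian_cart (unit B) (𝟙 B) r).comp_iff (Category.comp_id c)
    (Category.id_comp r)).2 ((hθ.isCartesian.comp_iff (Category.comp_id c)
      (Category.comp_id (𝟙 A))).2 hζ')
  set η' := comp (Cells.single η) (cart (unit B) r r) (Category.id_comp r) (Category.id_comp r)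
  set κ := comp (Cells.single (comp (Cells.single ζ) θ (Category.comp_id c)
    (Category.comp_id (𝟙 A)))) (cart (unit B) (𝟙 B) r) (Category.comp_id c) (Category.id_comp r)
  obtain ⟨δ, hδ⟩ := hη'.exists_comp_eq (dot (coconeCell γ) κ) (f' := f) (g' := 𝟙 A) rfl
    (Category.id_comp r)
  refine hasColimit_of_bijective (c := c ≫ l) δ fun R => ?_
  rw [← Function.Bijective.of_comp_iff' (hη'.bijective f (𝟙 A) (P.append R) rfl
    (Category.id_comp r))]
  have h' := (hγ.bijective_dot r R).comp (hκ.bijective (𝟙 Y) (𝟙 A) R (Category.id_comp c)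
    (Category.id_comp r))
  convert h' using 1
  funext ψ
  refine (comp_single_comp _ δ η' _ _ _ _ (Category.id_comp _) (Category.id_comp _) rfl
    (Category.id_comp _)).trans ?_
  rw [hδ]
  refine (comp_dot _ _ _ _ _ _ (Category.id_comp _)).trans ?_
  rw [comp_ids]
  rfl

theorem IsCocomplete.of_reflective {Φ : WeightClass X} {A B : X} (hB : IsCocomplete Φ B)
    (h : IsReflectiveIn A B) : IsCocomplete Φ A := by
  obtain ⟨r, l, hr, hl⟩ := h
  exact fun W D P hP f => HasColimit.of_reflective hr hl (hB P hP (f ≫ r))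

/-! ### Weights obtained by composition with companions -/

/-- The canonical nullary 2-cell into the companion `A(1, h)`. -/
noncomputable def companionUnit {A D : X} (h : D ⟶ A) : Cell h (𝟙 D) Chain.nil (companion h) :=
  factor (unit A) (𝟙 A) h h (𝟙 D) (tightId h) (Category.comp_id h) (Category.id_comp h)

/-- The row inserting a companion at the left of a chain. -/
noncomputable def insertCompanion {A D V : X} (h : D ⟶ A) (R : Chain V D) :
    Cells h (𝟙 V) R (Chain.cons (companion h) R) :=
  Cells.cons (companionUnit h) (Cells.ids R) rfl

theorem companionUnit_comp_cart {A D : X} (h : D ⟶ A) :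
    comp (Cells.single (companionUnit h)) (cart (unit A) (𝟙 A) h) (Category.comp_id h)
      (Category.id_comp h) = tightId h :=
  factor_comp_cart _ _ _ _ _ _ _ _

/-- The second triangle identity for the companion; the first is `companionUnit_comp_cart`. -/
theorem cart_dot_companionUnit {A D : X} (h : D ⟶ A) :
    dot (cart (unit A) (𝟙 A) h) (companionUnit h) = idCell (companion h) := by
  refine (isCartesian_cart (unit A) (𝟙 A) h).ext (Category.comp_id _) (Category.id_comp _) ?_
  refine (dot_comp_globular _ _ _ _ _).trans ?_
  rw [companionUnit_comp_cart]
  exact (eq_of_heq (dot_tightId_heq _)).trans (idCell_comp _ _ _).symm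

theorem tightId_comp_unitMap {A B D : X} (h : D ⟶ A) (g : A ⟶ B) :
    comp (Cells.single (tightId h)) (unitMap g) rfl rfl = tightId (h ≫ g) := by
  refine (comp_single_comp _ _ _ _ _ _ _ rfl rfl (Category.id_comp _) (Category.id_comp _)).trans ?_
  rw [unitCell_comp_unitMap, nil_comp_tightId]

/-- A companion at the left end of a chain can be bent into the left of the frame. The inverse acts
by the cartesian 2-cell of the companion, pushed forward along `g`; the triangle identities give the
two equations. -/
theorem bijective_comp_companionUnit {A B D V W : X} (h : D ⟶ A) (g : A ⟶ B) (y : V ⟶ W)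
    (p : Loose W B) (R : Chain V D) :
    Function.Bijective fun δ : Cell g y (Chain.cons (companion h) R) p =>
      comp (insertCompanion h R) δ rfl (Category.id_comp y) := by
  refine Function.bijective_iff_has_inverse.2 ⟨fun χ => dot (comp (Cells.single
    (cart (unit A) (𝟙 A) h)) (unitMap g) (Category.id_comp g) rfl) χ, fun δ => ?_, fun χ => ?_⟩
  · have H₁ := (Cells.IsComp.single (insertUnit (Chain.single (companion h)))
      (leftUnitor (companion h)) (Category.id_comp _) (Category.id_comp _)).append
        (Cells.IsComp.ids_left (Cells.ids R))
    rw [unitCell_comp_leftUnitor] at H₁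
    have hids : (Cells.single (idCell (companion h))).append (Cells.ids R) =
        Cells.ids (Chain.cons (companion h) R) := (Cells.ids_cons _ _).symm
    rw [hids] at H₁
    -- Absorbing a unit into the companion before `δ` amounts to letting `unitMap g` act on `δ`.
    have h₁ : comp ((Cells.single (leftUnitor (companion h))).append (Cells.ids R)) δ
        (Category.id_comp _) (Category.id_comp _) = dot (unitMap g) δ := by
      refine eq_dot_unitMap (R := Chain.cons (companion h) R) _ ?_
      refine Eq.trans ?_ ((H₁.comp_eq δ (Category.id_comp _) (Category.id_comp _)
        (Category.id_comp _) (Category.id_comp _) (Category.id_comp _)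
        (Category.id_comp _)).symm.trans (comp_ids δ _ _))
      rw [insertUnit, insertUnit, Cells.ids_cons, Cells.ids_single]
      rfl
    have H₂ : Cells.IsComp ((Cells.single (cart (unit A) (𝟙 A) h)).append (insertCompanion h R))
        ((Cells.single (leftUnitor (companion h))).append (Cells.ids R))
        (Cells.ids (Chain.cons (companion h) R)) := by
      rw [← hids, ← cart_dot_companionUnit]
      exact (Cells.IsComp.single (Cells.cons (cart (unit A) (𝟙 A) h)
        (Cells.single (companionUnit h)) rfl) (leftUnitor (companion h)) (Category.comp_id _)
          (Category.comp_id _)).append (Cells.IsComp.ids_left (Cells.ids R))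
    refine (comp_dot _ _ _ _ (Category.id_comp _) (Category.id_comp _) _).symm.trans ?_
    rw [← h₁]
    exact (H₂.comp_eq δ (Category.id_comp _) (Category.id_comp _)
        (Category.id_comp _) (Category.id_comp _) (Category.id_comp _)
        (Category.id_comp _)).symm.trans (comp_ids δ _ _)
  · refine (comp_dot (Cells.single (companionUnit h)) (Cells.ids R) _ χ rfl (Category.id_comp _)
      (Category.id_comp _)).trans ?_
    have h₁ := comp_single_comp (Cells.single (companionUnit h)) (cart (unit A) (𝟙 A) h)
      (unitMap g) (Category.comp_id h) (Category.id_comp h) rfl rfl rfl (Category.id_comp _)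
      (Category.id_comp g) rfl
    rw [companionUnit_comp_cart, tightId_comp_unitMap] at h₁
    rw [← h₁]
    exact (congrArg (dot _) (comp_ids χ _ _)).trans (tightId_dot χ)

/-- Bending the companion is bijective and commutes with the action of cocones. For `p = unit B`
this compares the colimit of `g` weighted by `A(1, h), P` with the `P`-weighted colimit of `h ≫ g`.
-/
theorem respects_companion_cons_iff {A B D W Y : X} {h : D ⟶ A} {P : Chain Y D} {g : A ⟶ B}
    {c : Y ⟶ B} {γ : Cocone (Chain.cons (companion h) P) g c} {γ' : Cocone P (h ≫ g) c}
    (H : comp (insertCompanion h P) (coconeCell γ) rfl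
      (Category.id_comp c) = coconeCell γ') (p : Loose W B) :
    Respects p γ ↔ Respects p γ' := by
  rw [respects_iff, respects_iff]
  refine forall_congr' fun R => ?_
  refine (Function.Bijective.of_comp_iff'
    (bijective_comp_companionUnit h g (𝟙 W) p (P.append R)) _).symm.trans ?_
  refine Eq.to_iff (congrArg _ (funext fun χ => ?_))
  refine Eq.trans ?_ ((comp_dot (insertCompanion h P) (Cells.ids R)
    (coconeCell γ) χ rfl (Category.id_comp _) (Category.id_comp _)).trans ?_)
  · rw [insertCompanion, insertCompanion, Cells.ids_append]
    rfl
  · rw [H, comp_ids]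

/-- Weights obtained from weights in `Φ` by composition with a companion are in the colimit
saturation of `Φ`. -/
theorem companion_cons_mem_saturation {Φ : WeightClass X} {A D Y : X} (h : D ⟶ A) {P : Chain Y D}
    (hP : P ∈ Φ Y D) : Chain.cons (companion h) P ∈ saturation Φ Y A := by
  -- The witness adjoins to `Φ` all its weights extended by a companion. Only the conditions on the
  -- adjoined weights have content, and each is transferred to the underlying weight in `Φ`.
  refine ⟨fun Y Z => Φ Y Z ∪ {Q | ∃ (D : X) (h : D ⟶ Z) (P : Chain Y D), P ∈ Φ Y D ∧
    Q = Chain.cons (companion h) P}, ⟨⟨?_, ?_, ?_⟩, ⟨?_, ?_, ?_⟩⟩, Or.inr ⟨D, h, P, hP, rfl⟩⟩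
  · rintro B hB Y Z _ (hQ | ⟨D, h, P, hP, rfl⟩) g
    · exact hB _ hQ g
    · obtain ⟨c, γ', hγ'⟩ := hB P hP (h ≫ g)
      obtain ⟨γ₀, hγ₀⟩ := (bijective_comp_companionUnit h g c (unit B) P).2 (coconeCell γ')
      obtain ⟨γ, rfl⟩ := exists_coconeCell_eq γ₀
      exact ⟨c, γ, (respects_companion_cons_iff hγ₀ (unit B)).2 hγ'⟩
  · rintro B B' k hB hk Y Z _ (hQ | ⟨D, h, P, hP, rfl⟩) g c γ hγ
    · exact hk _ hQ g c γ hγ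
    · obtain ⟨γ', hγ'⟩ := exists_coconeCell_eq (comp (insertCompanion h P) (coconeCell γ) rfl (Category.id_comp c))
      have h₁ := hk P hP _ c γ' ((respects_companion_cons_iff hγ'.symm (unit B)).1 hγ)
      obtain ⟨γ'', hγ''⟩ := exists_coconeCell_eq (comp (insertCompanion h P) (coconeCell (γ.map k)) rfl (Category.id_comp (c ≫ k)))
      refine (respects_companion_cons_iff hγ''.symm (unit B')).2 ((isColimit_iff γ'').2 ?_)
      have h₂ := (isColimit_iff _).1 h₁
      -- The two cocones to be compared lie under `(h ≫ g) ≫ k` and `h ≫ g ≫ k`, which are equal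
      -- only propositionally.
      have key : ∀ {f f' : D ⟶ B'} (_ : f = f') {α : Cell f (c ≫ k) P (unit B')}
          {β : Cell f' (c ≫ k) P (unit B')}, HEq α β →
          (∀ R : Chain B' Y, Function.Bijective fun χ : Cell (c ≫ k) (𝟙 B') R (unit B') =>
            dot α χ) →
          ∀ R : Chain B' Y, Function.Bijective fun χ : Cell (c ≫ k) (𝟙 B') R (unit B') =>
            dot β χ := by
        rintro f _ rfl α _ ⟨⟩ h
        exact h
      refine key (Category.assoc h g k) ?_ h₂
      rw [coconeCell_map, hγ'', coconeCell_map, hγ']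
      have h₃ := fun {m : D ⟶ B'} (e₀ : h ≫ g ≫ k = m) (e : (h ≫ g) ≫ k = m) =>
        comp_single_comp (insertCompanion h P) (coconeCell γ)
        (unitMap k) rfl (Category.id_comp c) e rfl e₀ (Category.id_comp _) rfl rfl
      have h₄ := h₃ rfl (Category.assoc _ _ _)
      rw [← h₄]
      have h₅ : ∀ {m m' : D ⟶ B'} (_ : m = m') (e : (h ≫ g) ≫ k = m) (e' : (h ≫ g) ≫ k = m')
          (α : Cell (h ≫ g) c P (unit B)), HEq (comp (Cells.single α) (unitMap k) e rfl)
            (comp (Cells.single α) (unitMap k) e' rfl) := by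
        rintro m _ rfl e e' α
        rfl
      exact h₅ (Category.assoc _ _ _) _ _ _
  · rintro V B p hB hp Y Z _ (hQ | ⟨D, h, P, hP, rfl⟩) g c γ hγ
    · exact hp _ hQ g c γ hγ
    · obtain ⟨γ', hγ'⟩ := exists_coconeCell_eq (comp (insertCompanion h P) (coconeCell γ) rfl (Category.id_comp c))
      exact (respects_companion_cons_iff hγ'.symm p).2 (hp P hP _ c γ'
        ((respects_companion_cons_iff hγ'.symm (unit B)).1 hγ))
  · exact fun B hB Y Z P hP => hB P (Or.inl hP)
  · exact fun B B' k _ hk Y Z P hP => hk P (Or.inl hP)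
  · exact fun V B p _ hp Y Z P hP => hp P (Or.inl hP)

/-- The `P`-colimit of `f` is obtained as the colimit of the identity weighted by `A(1, f), P`,
which lies in the saturation. -/
theorem isCocomplete_of_forall_saturation {Φ : WeightClass X} {A : X}
    (h : ∀ (Y : X) (P : Chain Y A), P ∈ saturation Φ Y A → HasColimit P (𝟙 A)) :
    IsCocomplete Φ A := by
  intro Y D P hP f
  obtain ⟨c, γ, hγ⟩ := h Y _ (companion_cons_mem_saturation f hP)
  obtain ⟨γ', hγ'⟩ := exists_coconeCell_eq (comp (insertCompanion f P) (coconeCell γ) rfl (Category.id_comp c))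
  have h' : HasColimit P (f ≫ 𝟙 A) :=
    ⟨c, γ', (respects_companion_cons_iff hγ'.symm (unit A)).1 hγ⟩
  rwa [Category.comp_id] at h'

end VirtualEquipment

section VirtualEquipment

variable {X : Type u} [Category.{v} X] [VirtualEquipment.{w, z} X]

/-! ### Cocompletions are fully faithful -/

theorem conjointUnit_dot_cart {A E V W : X} (j : A ⟶ E) {g : V ⟶ W} {R : Chain V A}
    {p : Loose W E} (χ : Cell j g R p) :
    dot (comp (Cells.single (conjointUnit j)) (cart (unit E) j (𝟙 E)) (Category.id_comp j)
      (Category.comp_id j)) χ = χ := by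
  rw [conjointUnit_comp_cart]
  exact tightId_dot χ

theorem comp_conjointUnit_cons {A E V V' W : X} {j : A ⟶ E} {p : Loose W A} {l : Loose W E}
    (ϖ : Cell (𝟙 A) (𝟙 W) ((Chain.single (conjoint j)).append (Chain.single l)) p)
    {t : V' ⟶ V} {g : V ⟶ W} {k : V' ⟶ W} {R : Chain V A} {R' : Chain V' A}
    (Ω : Cells (𝟙 A) t R' R) (ω : Cell j g R l) (e : t ≫ g = k) :
    comp Ω (comp (Cells.cons (conjointUnit j) (Cells.single ω) rfl) ϖ (Category.id_comp _)
        (Category.comp_id _)) (Category.id_comp _) e =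
      comp (Cells.cons (conjointUnit j) (Cells.single (comp Ω ω (Category.id_comp j) e)) rfl) ϖ
        (Category.id_comp _) (Category.comp_id _) := by
  have H : Cells.IsComp Ω (Cells.cons (conjointUnit j) (Cells.single ω) rfl)
      (Cells.cons (comp (Cells.nil (𝟙 A)) (conjointUnit j) (Category.id_comp _)
        (Category.id_comp _)) (Cells.single (comp Ω ω (Category.id_comp j) e)) rfl) :=
    Cells.IsComp.cons (Cells.nil (𝟙 A)) (conjointUnit j) (Cells.IsComp.single Ω ω _ _) _ _
  have h : comp (Cells.nil (𝟙 A)) (conjointUnit j) (Category.id_comp _) (Category.id_comp _) =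
      conjointUnit j := by
    rw [← Cells.ids_nil]
    exact comp_ids _ _ _
  rw [h] at H
  exact (H.comp_eq ϖ _ _ _ _ _ _).symm

theorem comp_transpose {A E V W : X} {j : A ⟶ E} {p : Loose W A} {l : Loose W E}
    (ϖ : Cell (𝟙 A) (𝟙 W) ((Chain.single (conjoint j)).append (Chain.single l)) p)
    {g : V ⟶ W} {R : Chain V A} (ω : Cell (𝟙 A) g R (res l j (𝟙 W))) :
    comp (Cells.single ω) (transpose ϖ) (Category.comp_id _) (Category.comp_id _) =
      comp (Cells.cons (conjointUnit j) (Cells.single (comp (Cells.single ω) (cart l j (𝟙 W))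
        (Category.id_comp j) (Category.comp_id g))) rfl) ϖ (Category.id_comp _)
        (Category.comp_id _) :=
  comp_conjointUnit_cons ϖ (Cells.single ω) (cart l j (𝟙 W)) (Category.comp_id g)

/-- Pasting with `ϖ` along the conjoint unit amounts to factoring through `l(j, 1)` and applying the
transpose of `ϖ`. If the latter is invertible, this is a bijection; injectivity is proved here and
surjectivity in `exists_of_isInvertible_transpose`. -/
theorem ext_of_isInvertible_transpose {A E V W : X} {j : A ⟶ E} {p : Loose W A} {l : Loose W E}
    {ϖ : Cell (𝟙 A) (𝟙 W) ((Chain.single (conjoint j)).append (Chain.single l)) p}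
    (h : IsInvertible (transpose ϖ)) {g : V ⟶ W} {R : Chain V A} {ω ω' : Cell j g R l}
    (e : comp (Cells.cons (conjointUnit j) (Cells.single ω) rfl) ϖ (Category.id_comp _)
        (Category.comp_id _) =
      comp (Cells.cons (conjointUnit j) (Cells.single ω') rfl) ϖ (Category.id_comp _)
        (Category.comp_id _)) : ω = ω' := by
  obtain ⟨α, rfl⟩ := (isCartesian_cart l j (𝟙 W)).exists_comp_eq ω (Category.id_comp j)
    (Category.comp_id g)
  obtain ⟨β, rfl⟩ := (isCartesian_cart l j (𝟙 W)).exists_comp_eq ω' (Category.id_comp j)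
    (Category.comp_id g)
  have e' := (comp_transpose ϖ α).trans (e.trans (comp_transpose ϖ β).symm)
  rw [h.isCartesian.ext (Category.comp_id _) (Category.comp_id _) e']

theorem exists_of_isInvertible_transpose {A E V W : X} {j : A ⟶ E} {p : Loose W A}
    {l : Loose W E} {ϖ : Cell (𝟙 A) (𝟙 W) ((Chain.single (conjoint j)).append (Chain.single l)) p}
    (h : IsInvertible (transpose ϖ)) {g : V ⟶ W} {R : Chain V A} (φ : Cell (𝟙 A) g R p) :
    ∃ ω : Cell j g R l, comp (Cells.cons (conjointUnit j) (Cells.single ω) rfl) ϖ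
      (Category.id_comp _) (Category.comp_id _) = φ := by
  obtain ⟨α, hα⟩ := h.isCartesian.exists_comp_eq φ (Category.comp_id _) (Category.comp_id _)
  exact ⟨_, (comp_transpose ϖ α).symm.trans hα⟩

theorem looseIso_hom_res_companion {A E : X} (j : A ⟶ E) :
    LooseIso (hom j j) (res (companion j) j (𝟙 A)) :=
  (isCartesian_cart (unit E) j j).looseIso
    (((isCartesian_cart (unit E) (𝟙 E) j).comp_iff (Category.comp_id j) (Category.id_comp j)).2
      (isCartesian_cart (companion j) j (𝟙 A)))

variable {Φ : WeightClass X} {A E : X} {j : A ⟶ E}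

/-- A cocompletion is dense: every 2-cell out of the conjoint `E(j, 1)`, suitably framed,
comes from the loose-identity. -/
theorem IsCocompletion.exists_cart_dot_eq (hj : IsCocompletion Φ j) {R : Chain A E}
    (ζ : Cell j j (Chain.cons (conjoint j) R) (unit E)) :
    ∃ υ : Cell (𝟙 E) j R (unit E), dot (cart (unit E) j (𝟙 E)) υ = ζ := by
  obtain ⟨l, ϖ, hϖ, ht, -, hu⟩ := hj.loose (hom j j)
  -- The companion is exact and restricts along `j` to `E(j, j)`, so by uniqueness it is the right
  -- lift `l`.
  obtain ⟨i, hi⟩ := hu _ (isExact_companion Φ j) (looseIso_hom_res_companion j)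
  obtain ⟨i', h₁, h₂⟩ := id hi
  obtain ⟨ζ', hζ⟩ := (isCartesian_cart (unit E) (𝟙 E) j).exists_comp_eq ζ (f' := j) (g' := 𝟙 A)
    (Category.comp_id _) (Category.id_comp _)
  -- The cell `ζ`, viewed as landing in `l` via `i`, is transposed to a cell into `E(j, j)` and
  -- factored through the lift; `i'` then carries the factor `ψ` back to the companion.
  obtain ⟨ψ, hψ, -⟩ := hϖ R (comp (Cells.cons (conjointUnit j) (Cells.single (comp
    (Cells.single ζ') i (Category.comp_id _) (Category.comp_id _))) rfl) ϖ (Category.id_comp _)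
    (Category.comp_id _))
  have h₃ : dot (cart (unit E) j (𝟙 E)) ψ =
      comp (Cells.single ζ') i (Category.comp_id _) (Category.comp_id _) := by
    refine ext_of_isInvertible_transpose ht (Eq.trans ?_ hψ)
    refine (conjointUnit_cons_dot_comp ψ ϖ).trans ?_
    rw [Cells.ids_single]
    rfl
  refine ⟨comp (Cells.single (comp (Cells.single ψ) i' (Category.comp_id _) (Category.comp_id _)))
    (cart (unit E) (𝟙 E) j) (Category.comp_id _) (Category.id_comp _), ?_⟩
  refine (dot_comp_globular _ _ _ (Category.comp_id _) (Category.id_comp _)).symm.trans ?_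
  have h₄ := (dot_comp_globular (cart (unit E) j (𝟙 E)) ψ i' (Category.comp_id _)
    (Category.comp_id _)).symm
  rw [h₃] at h₄
  rw [h₄, ← hζ]
  refine congrArg (fun α => comp (Cells.single α) _ _ _) ?_
  refine (comp_single_comp _ _ _ _ _ _ _ (Category.comp_id _) (Category.comp_id _)
    (Category.comp_id _) (Category.comp_id _)).trans ?_
  rw [vcomp] at h₁
  rw [h₁]
  exact comp_single_idCell _ _ _

theorem IsCocompletion.isFullyFaithful (hj : IsCocompletion Φ j) : IsFullyFaithful j := by
  obtain ⟨l, ϖ, -, ht, -, -⟩ := hj.loose (unit A)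
  -- Here `ε` corresponds to the unit of `A` under `l(j, 1) ≅ A(1, 1)`, and density yields `υ`, in
  -- effect a comparison from `l` to `E(1, j)`.
  obtain ⟨ε, hε⟩ := exists_of_isInvertible_transpose ht (unitCell A)
  obtain ⟨υ, hυ⟩ := hj.exists_cart_dot_eq (R := Chain.single l)
    (comp (Cells.single ϖ) (unitMap j) (Category.id_comp j) (Category.id_comp j))
  have comp_υ : ∀ {V : X} {g : V ⟶ A} {k : V ⟶ E} {R : Chain V A} (ω : Cell j g R l)
      (e : g ≫ j = k), comp (Cells.single ω) υ (Category.comp_id j) e =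
        comp (Cells.single (comp (Cells.cons (conjointUnit j) (Cells.single ω) rfl) ϖ
          (Category.id_comp _) (Category.comp_id _))) (unitMap j) (Category.id_comp j) e := by
    intro V g k R ω e
    refine Eq.trans ?_ (comp_single_comp (Cells.cons (conjointUnit j) (Cells.single ω) rfl) ϖ
      (unitMap j) _ _ _ _ (Category.id_comp j) e (Category.id_comp j)
      (Category.id_comp j)).symm
    rw [← hυ]
    refine Eq.trans (conjointUnit_dot_cart j _).symm ?_
    exact (comp_dot (Cells.single (conjointUnit j)) (Cells.single ω) (cart (unit E) j (𝟙 E)) υ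
      (Category.id_comp j) e (Category.comp_id j)).symm
  obtain ⟨η, hη⟩ := (isCartesian_cart (unit E) j j).exists_comp_eq (unitMap j)
    (Category.id_comp j) (Category.id_comp j)
  -- The candidate inverse of `η`: let `E(j, j)` act on `ε` to land in `l`, then transpose into
  -- `A(1, 1)`.
  let σ : Cell (𝟙 A) (𝟙 A) (Chain.single (hom j j)) (unit A) :=
    comp (Cells.cons (conjointUnit j) (Cells.single (dot (cart (unit E) j j) ε)) rfl) ϖ
      (Category.id_comp _) (Category.comp_id _)
  refine ⟨η, σ, ?_, ?_⟩
  -- After inserting the unit, the action on `ε` is that of the identity on `j`, so what remains is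
  -- the transpose of `ε`, namely the unit of `A`.
  · refine ext_unit_single ?_
    rw [comp_single_idCell]
    refine (comp_single_comp (Cells.single (unitCell A)) η σ (Category.id_comp _)
      (Category.id_comp _) (Category.id_comp _) (Category.id_comp _) _ _ _ _).symm.trans ?_
    refine (comp_conjointUnit_cons ϖ _ _ (Category.id_comp _)).trans ?_
    refine Eq.trans ?_ hε
    have h : comp (Cells.single (comp (Cells.single (unitCell A)) η (Category.id_comp _)
        (Category.id_comp _))) (dot (cart (unit E) j j) ε) (Category.id_comp j)
          (Category.id_comp (𝟙 A)) = ε := by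
      refine (comp_dot (Cells.single (comp (Cells.single (unitCell A)) η (Category.id_comp _)
        (Category.id_comp _))) (Cells.nil (𝟙 A)) (cart (unit E) j j) ε (Category.id_comp j)
          (Category.id_comp (𝟙 A)) (Category.id_comp j)).trans ?_
      rw [comp_single_comp _ _ _ _ _ _ _ (Category.id_comp j) (Category.id_comp j)
        (Category.id_comp j) (Category.id_comp j), hη, unitCell_comp_unitMap, ← Cells.ids_nil,
        comp_ids]
      exact tightId_dot ε
    exact congrArg (fun ω : Cell j (𝟙 A) Chain.nil l => comp (Cells.cons (conjointUnit j)
      (Cells.single ω) rfl) ϖ (Category.id_comp _) (Category.comp_id _)) h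
  -- Postcomposing with the cartesian 2-cell replaces `η` by `unitMap j`; by `comp_υ` the result is
  -- `υ` applied to the action on `ε`, and `ε` followed by `υ` is the identity on `j`.
  · refine (isCartesian_cart (unit E) j j).ext (Category.id_comp j) (Category.id_comp j) ?_
    refine (comp_single_comp _ _ _ _ _ _ _ (Category.id_comp j) (Category.id_comp j)
      (Category.id_comp j) (Category.id_comp j)).trans ?_
    rw [hη]
    refine (comp_υ (dot (cart (unit E) j j) ε) (Category.id_comp j)).symm.trans ?_
    refine (dot_comp_globular _ _ _ _ _).trans ?_
    have h : comp (Cells.single ε) υ (Category.comp_id j) (Category.id_comp j) = tightId j :=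
      (comp_υ ε _).trans ((congrArg (fun α : Cell (𝟙 A) (𝟙 A) Chain.nil (unit A) =>
        comp (Cells.single α) (unitMap j) (Category.id_comp j) (Category.id_comp j)) hε).trans
          (unitCell_comp_unitMap j))
    rw [h]
    exact (eq_of_heq (dot_tightId_heq _)).trans (idCell_comp _ _ _).symm

/-- If the identity admits a left extension along a cocompletion, then this left extension is left
adjoint to the cocompletion. -/
theorem IsCocompletion.exists_isLeftAdjoint (hj : IsCocompletion Φ j)
    (h : HasLeftExtension j (𝟙 A)) : ∃ l : E ⟶ A, IsLeftAdjoint l j := by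
  obtain ⟨c, γ, hγ⟩ := h
  -- The restriction `conjoint (𝟙 A)` is used in place of `unit A` because it is what the left
  -- extension is defined to lift.
  obtain ⟨l, ϖ, hϖ, -, -, hu⟩ := hj.loose (conjoint (𝟙 A))
  have hA : LooseIso (unit A) (conjoint (𝟙 A)) := by
    have h : IsCartesian (idCell (unit A)) :=
      IsInvertible.isCartesian ⟨idCell (unit A), idCell_comp _ _ _, idCell_comp _ _ _⟩
    exact h.looseIso (isCartesian_cart (unit A) (𝟙 A) (𝟙 A))
  have h₁ : LooseIso (conjoint (𝟙 A)) (res (companion j) j (𝟙 A)) :=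
    (hA.symm.trans hj.isFullyFaithful).trans (looseIso_hom_res_companion j)
  have hrefl : LooseIso (conjoint (𝟙 A)) (conjoint (𝟙 A)) :=
    ⟨idCell _, idCell _, idCell_comp _ _ _, idCell_comp _ _ _⟩
  -- Both `A(c, 1)` and the companion of `j` are isomorphic to `l`: the former as a right lift of
  -- the same loose-cell, the latter as an exact loose-cell with the required restriction.
  exact ⟨c, (IsRightLift.looseIso hγ hϖ hrefl).trans (hu _ (isExact_companion Φ j) h₁).symm⟩

end VirtualEquipment

end VDC

/-! ### The equivalences -/

theorem mainTheorem9 {X : Type u} [Category.{v} X] [VDC.VirtualEquipment.{w, z} X]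
    (Φ : VDC.WeightClass X) (A : X) :
    (VDC.IsCocomplete Φ A ↔ ∃ B : X, VDC.IsCocomplete Φ B ∧ VDC.IsReflectiveIn A B) ∧
    ∀ (E : X) (φ : A ⟶ E), VDC.IsCocompletion Φ φ →
      List.TFAE [
        VDC.IsCocomplete Φ A,
        ∃ B : X, VDC.IsCocomplete Φ B ∧ VDC.IsReflectiveIn A B,
        ∀ (Y F : X) (ψ : Y ⟶ F), VDC.IsCocompletion Φ ψ →
          ∀ g : Y ⟶ A, VDC.HasLeftExtension ψ g,
        VDC.HasLeftExtension φ (𝟙 A),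
        ∀ (Y : X) (P : VDC.Chain Y A), P ∈ VDC.saturation Φ Y A → VDC.HasColimit P (𝟙 A),
        ∃ l : E ⟶ A, VDC.IsLeftAdjoint l φ,
        ∃ (Y F : X) (ψ : Y ⟶ F), VDC.IsCocompletion Φ ψ ∧ VDC.IsReflectiveIn A F] := by
  have key : VDC.IsCocomplete Φ A ↔
      ∃ B : X, VDC.IsCocomplete Φ B ∧ VDC.IsReflectiveIn A B :=
    ⟨fun h => ⟨A, h, VDC.isReflectiveIn_refl A⟩, fun ⟨_, hB, h⟩ => hB.of_reflective h⟩
  refine ⟨key, fun E φ hφ => ?_⟩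
  tfae_have 1 ↔ 2 := key
  tfae_have 1 → 3 := by
    intro h Y F ψ hψ g
    obtain ⟨l, γ, hγ, -⟩ := hψ.tight g h
    exact ⟨l, γ, hγ⟩
  tfae_have 3 → 4 := fun h => h A E φ hφ (𝟙 A)
  tfae_have 4 → 6 := hφ.exists_isLeftAdjoint
  tfae_have 6 → 7 := fun ⟨l, hl⟩ => ⟨A, E, φ, hφ, φ, l, hφ.isFullyFaithful, hl⟩
  tfae_have 7 → 2 := fun ⟨_, F, _, hψ, h⟩ => ⟨F, hψ.cocomplete, h⟩
  -- The saturation is itself colimit equivalent to `Φ`, so a `Φ`-cocomplete object has all colimits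
  -- weighted by it.
  tfae_have 1 → 5 := fun h _ P hP =>
    (VDC.isGreatest_saturation Φ).1.1.cocomplete A h P hP (𝟙 A)
  tfae_have 5 → 1 := VDC.isCocomplete_of_forall_saturation
  tfae_finish
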